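/- Let $\mathbb{F}_q$ be the field with $q$ elements and $a\in\mathbb{F}_q^*$. A linear code $C\subseteq\mathbb{F}_q^n$ is an $[n,k,d]_q$-code if $\dim C=k$ and its minimum Hamming distance is exactly $d$. It is quasi-twisted (QT) of index $\ell$ with shift constant $a$, where $\ell\ge 1$ divides $n$, if $(c_0,\dots,c_{n-1})\in C$ implies $(ac_{n-\ell},\dots,ac_{n-1},c_0,\dots,c_{n-\ell-1})\in C$. For a polynomial $c_0+c_1x+\cdots+c_{m-1}x^{m-1}$, its $a$-circulant matrix is the $m\times m$ matrix with first row $(c_0,\dots,c_{m-1})$ in which each row $(r_0,\dots,r_{m-1})$ is followed by $(ar_{m-1},r_0,\dots,r_{m-2})$. For polynomials $g_1,\dots,g_\ell$ of degree less than $m$, with $a$-circulant matrices $G_1,\dots,G_\ell$, let $C_m(g_1,\dots,g_\ell)$ be the row space of $[G_1\,|\,G_2\,|\cdots|\,G_\ell]$. A digit string denotes the polynomial whose coefficients are its digits, starting with the constant term (missing coefficients are $0$). With $a=1$, each of the following five codes $C_m(g_1,\dots,g_\ell)$ has exactly the stated parameters, and it becomes a QT code of index $\ell$ with shift constant $1$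 when its columns are permuted so that column $j$ of block $b$ ($0\le j<m$, $0\le b<\ell$) is put at position $j\ell+b$. 1. $[85,16,45]_5$: $m=17$, $\ell=5$, with $g_1=1331311000103332$, $g_2=2030141001241411$, $g_3=3412143022013031$, $g_4=1123200013130012$, $g_5=4233002104312041$. 2. $[84,19,41]_5$: $m=21$, $\ell=4$, with $g_1=44010311002304111222$, $g_2=141032024233443231$, $g_3=1310443344442044020$, $g_4=4011113222243123010$. 3. $[84,13,48]_5$: $m=14$, $\ell=6$, with $g_1=34030034422424$, $g_2=4023414111414$, $g_3=10342023404034$, $g_4=44300024241344$, $g_5=3221030030213$, $g_6=433111043203$. 4. $[65,12,39]_7$: $m=13$, $\ell=5$, with $g_1=2322660251501$, $g_2=4415215004556$, $g_3=1551620013551$, $g_4=4030032120616$, $g_5=4626364150311$. 5. $[78,13,47]_7$: $m=13$, $\ell=6$, with $g_1=6536106450546$, $g_2=640410515651$, $g_3=32251003506$, $g_4=524220205542$, $g_5=520330333466$, $g_6=15211116242$. -/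

import Mathlib

namespace QTCode

instance fact_prime_five : Fact (Nat.Prime 5) := ⟨by norm_num⟩

instance fact_prime_seven : Fact (Nat.Prime 7) := ⟨by norm_num⟩

/-- The linear code `C`, with coordinates indexed by `ι`, is an `[n, k, d]`-code over `F`: it has
length `n`, dimension `k` and minimum Hamming distance exactly `d`. -/
def HasParameters {F ι : Type} [Field F] [DecidableEq F] [Fintype ι]
    (C : Submodule F (ι → F)) (n k d : ℕ) : Prop :=
  Fintype.card ι = n ∧ Module.finrank F C = k ∧
    IsLeast {w : ℕ | ∃ x ∈ C, ∃ y ∈ C, x ≠ y ∧ hammingDist x y = w} d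

/-- The constacyclic shift by `ℓ` positions (meant for `ℓ ≤ n`):
`(c_0, …, c_{n-1}) ↦ (a c_{n-ℓ}, …, a c_{n-1}, c_0, …, c_{n-ℓ-1})`. -/
def constaShift {F : Type} [Field F] {n : ℕ} (ℓ : ℕ) (a : F) (c : Fin n → F) : Fin n → F :=
  fun i =>
    if (i : ℕ) < ℓ then a * c ⟨(i + (n - ℓ)) % n, Nat.mod_lt _ i.pos⟩
    else c ⟨i - ℓ, lt_of_le_of_lt (Nat.sub_le _ _) i.isLt⟩

/-- `C` is a quasi-twisted code of index `ℓ` with shift constant `a`. -/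
def IsQuasiTwisted {F : Type} [Field F] {n : ℕ} (ℓ : ℕ) (a : F)
    (C : Submodule F (Fin n → F)) : Prop :=
  a ≠ 0 ∧ 0 < ℓ ∧ ℓ ∣ n ∧ ∀ c ∈ C, constaShift ℓ a c ∈ C

/-- The `a`-circulant (twistulant) `m × m` matrix with first row `(c_0, …, c_{m-1})`; each row is
the constacyclic shift by one position of the previous row. The subtraction is modulo `m`. -/
def twistulant {F : Type} [Field F] {m : ℕ} (a : F) (c : Fin m → F) : Matrix (Fin m) (Fin m) F :=
  fun i j => if i ≤ j then c (j - i) else a * c (j - i)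

/-- The vector `(c_0, …, c_{m-1})` of the polynomial `c_0 + c_1 x + ⋯` whose coefficients are
listed in `g`, starting with the constant term; missing coefficients are zero. -/
def coeffVec {F : Type} [Field F] (m : ℕ) (g : List F) : Fin m → F :=
  fun j => g.getD j 0

/-- The horizontal join `[G_1 | G_2 | ⋯ | G_ℓ]` of the `a`-circulant matrices of the polynomials
`g_1, …, g_ℓ`; the column `(b, j)` is the column `j` of the block `b`. -/
def blockMatrix {F : Type} [Field F] (m : ℕ) {ℓ : ℕ} (a : F) (g : Fin ℓ → List F) :
    Matrix (Fin m) (Fin ℓ × Fin m) F :=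
  fun i p => twistulant a (coeffVec m (g p.1)) i p.2

/-- The row space of the block matrix `[G_1 | G_2 | ⋯ | G_ℓ]`. -/
def blockCode {F : Type} [Field F] (m : ℕ) {ℓ : ℕ} (a : F) (g : Fin ℓ → List F) :
    Submodule F (Fin ℓ × Fin m → F) :=
  Submodule.span F (Set.range (blockMatrix m a g))

/-- The column permutation between block form and quasi-twisted form: the column `j` of the
block `b` is put at the position `j ℓ + b`. -/
def interleave {F : Type} [Field F] {m ℓ : ℕ} (C : Submodule F (Fin ℓ × Fin m → F)) :
    Submodule F (Fin (m * ℓ) → F) :=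
  C.map (LinearMap.funLeft F F fun s : Fin (m * ℓ) => (s.modNat, s.divNat))

/-- Block polynomials of the code of length 85 over the field with 5 elements. -/
def g85 : Fin 5 → List (ZMod 5) :=
  ![[1,3,3,1,3,1,1,0,0,0,1,0,3,3,3,2],
    [2,0,3,0,1,4,1,0,0,1,2,4,1,4,1,1],
    [3,4,1,2,1,4,3,0,2,2,0,1,3,0,3,1],
    [1,1,2,3,2,0,0,0,1,3,1,3,0,0,1,2],
    [4,2,3,3,0,0,2,1,0,4,3,1,2,0,4,1]]

/-- Block polynomials of the first code of length 84 over the field with 5 elements. -/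
def g84 : Fin 4 → List (ZMod 5) :=
  ![[4,4,0,1,0,3,1,1,0,0,2,3,0,4,1,1,1,2,2,2],
    [1,4,1,0,3,2,0,2,4,2,3,3,4,4,3,2,3,1],
    [1,3,1,0,4,4,3,3,4,4,4,4,2,0,4,4,0,2,0],
    [4,0,1,1,1,1,3,2,2,2,2,4,3,1,2,3,0,1,0]]

/-- Block polynomials of the second code of length 84 over the field with 5 elements. -/
def g84' : Fin 6 → List (ZMod 5) :=
  ![[3,4,0,3,0,0,3,4,4,2,2,4,2,4],
    [4,0,2,3,4,1,4,1,1,1,4,1,4],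
    [1,0,3,4,2,0,2,3,4,0,4,0,3,4],
    [4,4,3,0,0,0,2,4,2,4,1,3,4,4],
    [3,2,2,1,0,3,0,0,3,0,2,1,3],
    [4,3,3,1,1,1,0,4,3,2,0,3]]

/-- Block polynomials of the code of length 65 over the field with 7 elements. -/
def g65 : Fin 5 → List (ZMod 7) :=
  ![[2,3,2,2,6,6,0,2,5,1,5,0,1],
    [4,4,1,5,2,1,5,0,0,4,5,5,6],
    [1,5,5,1,6,2,0,0,1,3,5,5,1],
    [4,0,3,0,0,3,2,1,2,0,6,1,6],
    [4,6,2,6,3,6,4,1,5,0,3,1,1]]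

/-- Block polynomials of the code of length 78 over the field with 7 elements. -/
def g78 : Fin 6 → List (ZMod 7) :=
  ![[6,5,3,6,1,0,6,4,5,0,5,4,6],
    [6,4,0,4,1,0,5,1,5,6,5,1],
    [3,2,2,5,1,0,0,3,5,0,6],
    [5,2,4,2,2,0,2,0,5,5,4,2],
    [5,2,0,3,3,0,3,3,3,4,6,6],
    [1,5,2,1,1,1,1,6,2,4,2]]

end QTCode

namespace QTCode

/-- A table of eight entries. -/
structure Tab (α : Type) where
  (m0 m1 m2 m3 m4 m5 m6 m7 : α)

namespace Tab

def ofFn {α : Type} (f : ℕ → α) : Tab α := ⟨f 0, f 1, f 2, f 3, f 4, f 5, f 6, f 7⟩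

def get {α : Type} (t : Tab α) : ℕ → α
  | 0 => t.m0 | 1 => t.m1 | 2 => t.m2 | 3 => t.m3 | 4 => t.m4 | 5 => t.m5 | 6 => t.m6 | _ => t.m7

end Tab

noncomputable section

/-- `sel u t k = k (t.get u)`, arranged so that the kernel shares the evaluation of the entries. -/
def sel (u : ℕ) : Tab ℕ → (ℕ → ℕ) → ℕ :=
  Nat.rec (fun t k => k t.m0) (fun u _ => Nat.rec (fun t k => k t.m1) (fun u _ =>
    Nat.rec (fun t k => k t.m2) (fun u _ => Nat.rec (fun t k => k t.m3) (fun u _ =>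
    Nat.rec (fun t k => k t.m4) (fun u _ => Nat.rec (fun t k => k t.m5) (fun u _ =>
    Nat.rec (fun t k => k t.m6) (fun _ _ t k => k t.m7) u) u) u) u) u) u) u

/-- `sel₂ u t k = k (t.get u)` for tables of tables. -/
def sel₂ (u : ℕ) : Tab (Tab ℕ) → (Tab ℕ → ℕ) → ℕ :=
  Nat.rec (fun t k => k t.m0) (fun u _ => Nat.rec (fun t k => k t.m1) (fun u _ =>
    Nat.rec (fun t k => k t.m2) (fun u _ => Nat.rec (fun t k => k t.m3) (fun u _ =>
    Nat.rec (fun t k => k t.m4) (fun u _ => Nat.rec (fun t k => k t.m5) (fun u _ =>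
    Nat.rec (fun t k => k t.m6) (fun _ _ t k => k t.m7) u) u) u) u) u) u) u

/-- A family of vectors, one per 7-bit lane. -/
structure Batch where
  size : ℕ
  ones : ℕ
  base : ℕ
  cols : List (Tab ℕ)
  pairs : List (Tab (Tab ℕ))

def pairUp : List (Tab ℕ) → List (Tab (Tab ℕ))
  | t :: t' :: ts =>
    (Tab.ofFn fun s => Tab.ofFn fun s' => sel s t fun a => sel s' t' fun b => Nat.add a b) ::
      pairUp ts
  | [t] => [Tab.ofFn fun s => Tab.ofFn fun _ => sel s t fun a => a]
  | [] => []

def Batch.ofCols (size ones base : ℕ) (cols : List (Tab ℕ)) : Batch :=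
  ⟨size, ones, base, cols, pairUp cols⟩

def repeatLanes (w x n : ℕ) : ℕ :=
  Nat.rec (motive := fun _ => ℕ) 0 (fun _ ih => Nat.add x (Nat.shiftLeft ih w)) n

def combineCol (p w w' r : ℕ) (t t' : Tab ℕ) : Tab ℕ :=
  (fun g : Tab ℕ => Tab.ofFn fun s =>
    Nat.rec (motive := fun _ => ℕ → ℕ → ℕ → ℕ) (fun acc _ _ => acc)
      (fun _ ih acc y v => sel (Nat.mod y p) g fun b => ih (Nat.add acc (Nat.shiftLeft b v))
        (Nat.add y (Nat.mul 2 r)) (Nat.add v (Nat.mul 2 w')))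
      (Nat.div p 2) (sel s t fun a => a) (Nat.add s r) w)
  (Tab.ofFn fun y => sel (Nat.mod y p) t' fun a => sel (Nat.mod (Nat.add y r) p) t' fun b =>
    Nat.add a (Nat.shiftLeft b w'))

def zip₃ (f : ℕ → Tab ℕ → Tab ℕ → Tab ℕ) (l : List ℕ) :
    List (Tab ℕ) → List (Tab ℕ) → List (Tab ℕ) :=
  List.rec (motive := fun _ => List (Tab ℕ) → List (Tab ℕ) → List (Tab ℕ)) (fun _ _ => [])
    (fun r _ ih ts us => List.rec (motive := fun _ => List (Tab ℕ)) [] (fun t ts _ =>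
      List.rec (motive := fun _ => List (Tab ℕ)) [] (fun u us _ => f r t u :: ih ts us) us) ts) l

def combine (p : ℕ) (row : List ℕ) (e e' : Batch) : Batch :=
  (fun w w' => Batch.ofCols (Nat.add e.size (Nat.mul (Nat.pred p) e'.size))
    (Nat.add e.ones (Nat.shiftLeft (repeatLanes w' e'.ones (Nat.pred p)) w))
    (Nat.add e.base (Nat.shiftLeft (repeatLanes w' e'.base (Nat.pred p)) w))
    (zip₃ (combineCol p w w') row e.cols e'.cols))
  (Nat.mul 7 e.size) (Nat.mul 7 e'.size)

def Batch.nth : List Batch → ℕ → Batch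
  | [], _ => ⟨0, 0, 0, [], []⟩
  | e :: _, 0 => e
  | _ :: es, a + 1 => Batch.nth es a

def stepLevel (p cap : ℕ) (row : List ℕ) : ℕ → List Batch → List Batch
  | a, e :: e' :: es =>
    (bif Nat.ble (a + 1) cap then combine p row e e' else e) :: stepLevel p cap row (a + 1) (e' :: es)
  | _, es => es

def baseLevel (n top t : ℕ) : List Batch :=
  (List.range (t + 1)).map fun a =>
    Batch.ofCols 1 1 (top - a) (List.replicate n (Tab.ofFn fun s => bif Nat.beq s 0 then 1 else 0))

def headLevel : List (List Batch) → List Batch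
  | l :: _ => l
  | [] => []

def levels (p n top t : ℕ) : List (List ℕ) → List ℕ → List (List Batch)
  | row :: rows, cap :: caps =>
    (fun ls => stepLevel p cap row 0 (headLevel ls) :: ls) (levels p n top t rows caps)
  | _, _ => [baseLevel n top t]

def lookupSum (p : ℕ) (ts : List (Tab (Tab ℕ))) : ℕ → ℕ → ℕ :=
  List.rec (motive := fun _ => ℕ → ℕ → ℕ) (fun _ acc => acc)
    (fun t _ ih U acc => sel₂ (Nat.mod (Nat.mod U 1024) p) t fun t' =>
      sel (Nat.mod (Nat.mod (Nat.div U 1024) 1024) p) t' fun b =>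
        ih (Nat.div U 1048576) (Nat.add acc b)) ts

def checkBatch (p : ℕ) (e : Batch) (U : ℕ) : Bool :=
  Nat.beq (Nat.land (lookupSum p e.pairs U e.base) (Nat.mul 64 e.ones)) 0

def pack : List ℕ → ℕ
  | [] => 0
  | x :: xs => Nat.add x (Nat.mul 1024 (pack xs))

def checkTree (p M : ℕ) : List (List ℕ) → List ℕ → List (List Batch) → ℕ → ℕ → Bool
  | row :: rows, cap :: caps, l :: ls, a, U =>
    bif Nat.ble (Batch.nth l a).size M then checkBatch p (Batch.nth l a) U else
      checkTree p M rows caps ls a U && (bif Nat.ble (a + 1) cap then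
        (List.range' 1 (p - 1)).all fun x =>
          checkTree p M rows caps ls (a + 1) (Nat.add U (Nat.mul x (pack row))) else true)
  | _, _, l :: _, a, U => checkBatch p (Batch.nth l a) U
  | _, _, [], _, _ => false

def tasks (p M : ℕ) : ℕ → List (List ℕ) → List ℕ → List (List Batch) → ℕ → ℕ → List Bool
  | D + 1, row :: rows, cap :: caps, _ :: ls, a, U =>
      tasks p M D rows caps ls a U ++ (bif Nat.ble (a + 1) cap then
        (List.range' 1 (p - 1)).flatMap fun x =>
          tasks p M D rows caps ls (a + 1) (Nat.add U (Nat.mul x (pack row))) else [])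
  | _, rows, caps, ls, a, U => [checkTree p M rows caps ls a U]

def allTasks (p M : ℕ) : ℕ → List (List ℕ) → List ℕ → List (List Batch) → List Bool
  | D, row :: rows, cap :: caps, _ :: ls =>
     (bif Nat.ble 1 cap then tasks p M (D - 1) rows caps ls 1 (pack row) else []) ++
       allTasks p M (D - 1) rows caps ls
  | _, _, _, _ => []

def unpack : ℕ → ℕ → List ℕ
  | 0, _ => []
  | n + 1, x => Nat.mod x 8 :: unpack n (Nat.div x 8)

def chunk (p n top t M D : ℕ) (rows : List (List ℕ)) (caps : List ℕ) (K c : ℕ) : Bool :=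
  (allTasks p M D rows caps (levels p n top t rows caps)).zipIdx.all
    fun q => bif Nat.beq (q.2 % K) c then q.1 else true

end

theorem sel_eq (u : ℕ) (t : Tab ℕ) (k : ℕ → ℕ) : sel u t k = k (t.get u) := by
  match u with
  | 0 | 1 | 2 | 3 | 4 | 5 | 6 => rfl
  | _ + 7 => rfl

theorem sel₂_eq (u : ℕ) (t : Tab (Tab ℕ)) (k : Tab ℕ → ℕ) : sel₂ u t k = k (t.get u) := by
  match u with
  | 0 | 1 | 2 | 3 | 4 | 5 | 6 => rfl
  | _ + 7 => rfl

theorem Tab.get_ofFn {α : Type} (f : ℕ → α) {u : ℕ} (hu : u < 8) : (Tab.ofFn f).get u = f u := by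
  interval_cases u <;> rfl

/-- The number whose 7-bit lanes are the entries of `l`. -/
def lanes (l : List ℕ) : ℕ := Nat.ofDigits 128 l

theorem lanes_cons (a : ℕ) (l : List ℕ) : lanes (a :: l) = a + 128 * lanes l := by
  simp [lanes, Nat.ofDigits_cons]

theorem lanes_append (l l' : List ℕ) : lanes (l ++ l') = lanes l + 2 ^ (7 * l.length) * lanes l' := by
  rw [lanes, Nat.ofDigits_append, pow_mul]; rfl

theorem ofDigits_map_add {α : Type} (b : ℕ) (l : List α) (f g : α → ℕ) :
    Nat.ofDigits b (l.map f) + Nat.ofDigits b (l.map g) =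
      Nat.ofDigits b (l.map fun i => f i + g i) := by
  induction l with
  | nil => simp
  | cons i l ih =>
    simp only [List.map_cons, Nat.ofDigits_cons, ← ih]
    ring

theorem ofDigits_map_mul {α : Type} (b : ℕ) (l : List α) (x : ℕ) (f : α → ℕ) :
    x * Nat.ofDigits b (l.map f) = Nat.ofDigits b (l.map fun i => x * f i) := by
  induction l with
  | nil => simp
  | cons i l ih =>
    simp only [List.map_cons, Nat.ofDigits_cons, ← ih]
    ring

theorem lanes_zero {α : Type} (l : List α) : lanes (l.map fun _ => 0) = 0 := by
  induction l with
  | nil => rfl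
  | cons i l ih => rw [List.map_cons, lanes_cons, ih]

theorem sum_lanes_map {α β : Type} (l : List α) (l' : List β) (f : α → β → ℕ) :
    (l.map fun i => lanes (l'.map (f i))).sum = lanes (l'.map fun v => (l.map fun i => f i v).sum) := by
  induction l with
  | nil => exact (lanes_zero l').symm
  | cons i l ih =>
    simp only [List.map_cons, List.sum_cons, ih]
    exact ofDigits_map_add ..

theorem lt_of_land_lanes_eq_zero {α : Type} (l : List α) (f : α → ℕ) (hf : ∀ v ∈ l, f v < 128)
    (h : Nat.land (lanes (l.map f)) (64 * lanes (l.map fun _ => 1)) = 0) : ∀ v ∈ l, f v < 64 := by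
  induction l with
  | nil => simp
  | cons v l ih =>
    have key : ∀ a < 128, a &&& 64 = 0 → a < 64 := by decide
    have hv : f v < 128 := hf v (by simp)
    simp only [List.map_cons, lanes_cons] at h
    set X := lanes (l.map f)
    set Y := lanes (l.map fun _ => 1)
    have h' : (f v + 128 * X) &&& (64 + 128 * (64 * Y)) = 0 := by
      rw [← h]; congr 1; ring
    have h1 : f v &&& 64 = 0 := by
      have := congrArg (· % 2 ^ 7) h'
      simp only [Nat.and_mod_two_pow] at this
      simpa [Nat.add_mul_mod_self_left, Nat.mod_eq_of_lt hv] using this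
    have h2 : X &&& (64 * Y) = 0 := by
      have := congrArg (· >>> 7) h'
      simp only [Nat.shiftRight_and_distrib] at this
      simp only [Nat.shiftRight_eq_div_pow] at this
      have e1 : (f v + 128 * X) / 2 ^ 7 = X := by omega
      have e2 : (64 + 128 * (64 * Y)) / 2 ^ 7 = 64 * Y := by omega
      rw [e1, e2] at this
      simpa using this
    intro w hw
    rcases List.mem_cons.1 hw with rfl | hw
    · exact key _ hv h1
    · exact ih (fun v hv => hf v (List.mem_cons_of_mem _ hv)) h2 w hw

/-! ### Messages -/

/-- The messages of length `caps.length` over `{0, …, p - 1}` whose prefix weights, increased by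
`a`, stay below the bounds `caps`. -/
def messages (p : ℕ) : List ℕ → ℕ → List (List ℕ)
  | [], _ => [[]]
  | c :: cs, a => (messages p cs a).map (0 :: ·) ++
      if a + 1 ≤ c then
        (List.range' 1 (p - 1)).flatMap fun x => (messages p cs (a + 1)).map (x :: ·)
      else []

def weight (v : List ℕ) : ℕ := v.countP (· ≠ 0)

theorem weight_zero_cons (v : List ℕ) : weight (0 :: v) = weight v := by simp [weight]

theorem weight_cons {x : ℕ} (hx : x ≠ 0) (v : List ℕ) : weight (x :: v) = weight v + 1 := by
  simp [weight, hx]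

/-- The column `c` of the linear combination of `rows` with coefficients `v`. -/
def dot : List ℕ → List (List ℕ) → ℕ → ℕ
  | x :: v, row :: rows, c => x * row.getD c 0 + dot v rows c
  | _, _, _ => 0

def zeroLane (p : ℕ) (rows : List (List ℕ)) (c s : ℕ) (v : List ℕ) : ℕ :=
  if (s + dot v rows c) % p = 0 then 1 else 0

structure Batch.Valid (p n top : ℕ) (rows : List (List ℕ)) (caps : List ℕ) (a : ℕ) (e : Batch) :
    Prop where
  size : e.size = (messages p caps a).length
  ones : e.ones = lanes ((messages p caps a).map fun _ => 1)
  base : e.base = lanes ((messages p caps a).map fun v => top - (a + weight v))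
  pairs : e.pairs = pairUp e.cols
  cols : ∃ T : ℕ → Tab ℕ, e.cols = (List.range n).map T ∧ ∀ c < n, ∀ s < p,
    (T c).get s = lanes ((messages p caps a).map (zeroLane p rows c s))

theorem repeatLanes_eq (w x n : ℕ) : repeatLanes w x n = ∑ i ∈ Finset.range n, x * 2 ^ (w * i) := by
  induction n with
  | zero => rfl
  | succ n ih =>
    have : repeatLanes w x (n + 1) = x + (repeatLanes w x n) <<< w := rfl
    rw [this, ih, Nat.shiftLeft_eq, Finset.sum_range_succ', Finset.sum_mul, add_comm]
    simp only [mul_zero, pow_zero, mul_one, mul_add, pow_add, mul_assoc]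

theorem lanes_flatMap {α : Type} (l : List α) (N a : ℕ) (f : ℕ → α → ℕ) :
    lanes ((List.range' a N).flatMap fun x => l.map (f x)) =
      ∑ i ∈ Finset.range N, lanes (l.map (f (a + i))) * 2 ^ (7 * l.length * i) := by
  induction N generalizing a with
  | zero => rfl
  | succ N ih =>
    rw [List.range'_succ, List.flatMap_cons, lanes_append, ih, Finset.sum_range_succ', add_comm,
      List.length_map, Finset.mul_sum]
    simp only [mul_zero, pow_zero, mul_one, add_zero, mul_add, pow_add]
    congr 1
    refine Finset.sum_congr rfl fun i _ => ?_
    rw [show a + 1 + i = a + (i + 1) by ring]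
    ring

theorem lanes_messages_cons (p c a : ℕ) (cs : List ℕ) (h : a + 1 ≤ c) (f : List ℕ → ℕ) :
    lanes ((messages p (c :: cs) a).map f) =
      lanes ((messages p cs a).map fun v => f (0 :: v)) +
      (∑ i ∈ Finset.range (p - 1), lanes ((messages p cs (a + 1)).map fun v => f ((i + 1) :: v)) *
        2 ^ (7 * (messages p cs (a + 1)).length * i)) * 2 ^ (7 * (messages p cs a).length) := by
  rw [messages, if_pos h, List.map_append, lanes_append, List.map_flatMap]
  simp only [List.map_map, List.length_map]
  have := lanes_flatMap (messages p cs (a + 1)) (p - 1) 1 fun x v => f (x :: v)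
  simp only [Function.comp_def]
  rw [this, mul_comm]
  simp only [add_comm 1]

theorem lanes_messages_cons_of_lt (p c a : ℕ) (cs : List ℕ) (h : ¬ a + 1 ≤ c) (f : List ℕ → ℕ) :
    lanes ((messages p (c :: cs) a).map f) = lanes ((messages p cs a).map fun v => f (0 :: v)) := by
  rw [messages, if_neg h, List.append_nil, List.map_map]; rfl

theorem zip₃_map {α : Type} (f : ℕ → Tab ℕ → Tab ℕ → Tab ℕ) (l : List α) (r : α → ℕ)
    (t u : α → Tab ℕ) :
    zip₃ f (l.map r) (l.map t) (l.map u) = l.map fun i => f (r i) (t i) (u i) := by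
  induction l with
  | nil => rfl
  | cons i l ih => rw [List.map_cons (f := fun i => f (r i) (t i) (u i)), ← ih]; rfl

theorem get_combineCol {p : ℕ} (hp : p ≤ 7) (hodd : p % 2 = 1) (w w' r : ℕ) (t t' : Tab ℕ) {s : ℕ}
    (hs : s < p) :
    (combineCol p w w' r t t').get s = t.get s +
      (∑ i ∈ Finset.range (p - 1), t'.get ((s + (i + 1) * r) % p) * 2 ^ (w' * i)) * 2 ^ w := by
  have hp0 : 0 < p := by omega
  have key : ∀ h acc y v : ℕ,
      (Nat.rec (motive := fun _ => ℕ → ℕ → ℕ → ℕ) (fun acc _ _ => acc)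
        (fun _ ih acc y v => sel (Nat.mod y p) (Tab.ofFn fun y => sel (Nat.mod y p) t' fun a =>
          sel (Nat.mod (Nat.add y r) p) t' fun b => Nat.add a (Nat.shiftLeft b w')) fun b =>
          ih (Nat.add acc (Nat.shiftLeft b v)) (Nat.add y (Nat.mul 2 r)) (Nat.add v (Nat.mul 2 w')))
        h acc y v : ℕ) =
      acc + (∑ i ∈ Finset.range (2 * h), t'.get ((y + i * r) % p) * 2 ^ (w' * i)) * 2 ^ v := by
    intro h
    induction h with
    | zero => intro acc y v; simp
    | succ h ih =>
      intro acc y v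
      have hy : y % p < 8 := lt_of_lt_of_le (Nat.mod_lt _ hp0) (by omega)
      simp only [sel_eq]
      simp only [sel_eq] at ih
      rw [ih]
      rw [show y.mod p = y % p from rfl, Tab.get_ofFn _ hy]
      change acc + (t'.get (y % p % p) + (t'.get ((y % p + r) % p)) <<< w') <<< v + _ = _
      rw [Nat.shiftLeft_eq, Nat.shiftLeft_eq, Nat.mod_mod, Nat.mod_add_mod,
        show 2 * (h + 1) = 2 * h + 1 + 1 by ring, Finset.sum_range_succ', Finset.sum_range_succ']
      change _ + (∑ i ∈ Finset.range (2 * h), t'.get ((y + 2 * r + i * r) % p) * 2 ^ (w' * i)) *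
        2 ^ (v + 2 * w') = _
      have e : ∀ i, t'.get ((y + (i + 1 + 1) * r) % p) * 2 ^ (w' * (i + 1 + 1)) =
          t'.get ((y + 2 * r + i * r) % p) * 2 ^ (w' * i) * 2 ^ (2 * w') := by
        intro i
        rw [show y + (i + 1 + 1) * r = y + 2 * r + i * r by ring]
        ring
      simp only [e, ← Finset.sum_mul]
      simp only [zero_add, one_mul, mul_one, zero_mul, add_zero, mul_zero, pow_zero, pow_add]
      ring
  have : 2 * (p / 2) = p - 1 := by omega
  have h0 := key (p / 2) (sel s t fun a => a) (s + r) w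
  rw [combineCol, Tab.get_ofFn _ (by omega)]
  refine h0.trans ?_
  rw [sel_eq, this]
  congr 2
  refine Finset.sum_congr rfl fun i _ => ?_
  rw [show s + r + i * r = s + (i + 1) * r by ring]

theorem messages_length_cons (p c a : ℕ) (cs : List ℕ) (h : a + 1 ≤ c) :
    (messages p (c :: cs) a).length =
      (messages p cs a).length + (p - 1) * (messages p cs (a + 1)).length := by
  rw [messages, if_pos h]
  simp [List.length_flatMap]

theorem eq_map_getD {n : ℕ} {row : List ℕ} (h : row.length = n) :
    row = (List.range n).map fun c => row.getD c 0 := by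
  apply List.ext_getElem
  · simp [h]
  · intro i h1 h2
    simp [List.getElem?_eq_getElem h1]

theorem Batch.Valid.combine {p n top : ℕ} {rows : List (List ℕ)} {caps : List ℕ} {a c : ℕ}
    {e e' : Batch} {row : List ℕ} (hp : p ≤ 7) (hodd : p % 2 = 1) (hrow : row.length = n)
    (hc : a + 1 ≤ c) (he : e.Valid p n top rows caps a) (he' : e'.Valid p n top rows caps (a + 1)) :
    (combine p row e e').Valid p n top (row :: rows) (c :: caps) a := by
  refine ⟨?_, ?_, ?_, rfl, ?_⟩
  · rw [messages_length_cons _ _ _ _ hc, ← he.size, ← he'.size]; rfl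
  · change e.ones + (repeatLanes (7 * e'.size) e'.ones (p - 1)) <<< (7 * e.size) = _
    rw [lanes_messages_cons _ _ _ _ hc, ← he.ones, ← he'.ones, ← he.size, ← he'.size,
      Nat.shiftLeft_eq, repeatLanes_eq]
  · change e.base + (repeatLanes (7 * e'.size) e'.base (p - 1)) <<< (7 * e.size) = _
    rw [lanes_messages_cons _ _ _ _ hc, ← he.size, ← he'.size, Nat.shiftLeft_eq, repeatLanes_eq,
      he.base, he'.base]
    simp only [weight_zero_cons, weight_cons (Nat.succ_ne_zero _), add_assoc, add_comm 1]
  · obtain ⟨T, hT, hT'⟩ := he.cols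
    obtain ⟨T₁, hT₁, hT₁'⟩ := he'.cols
    refine ⟨fun i => combineCol p (7 * e.size) (7 * e'.size) (row.getD i 0) (T i) (T₁ i), ?_, ?_⟩
    · change zip₃ _ row e.cols e'.cols = _
      conv_lhs => rw [eq_map_getD hrow, hT, hT₁]
      exact zip₃_map ..
    · intro i hi s hs
      have hp0 : 0 < p := by omega
      rw [get_combineCol hp hodd _ _ _ _ _ hs, lanes_messages_cons _ _ _ _ hc, hT' i hi s hs,
        ← he.size, ← he'.size]
      congr 2
      · congr 2; funext v; simp [zeroLane, dot]
      · refine Finset.sum_congr rfl fun x _ => ?_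
        rw [hT₁' i hi _ (Nat.mod_lt _ hp0)]
        congr 3; funext v
        simp only [zeroLane, dot, Nat.mod_add_mod, add_assoc]
        rfl

theorem Batch.Valid.cons {p n top : ℕ} {rows : List (List ℕ)} {caps : List ℕ} {a c : ℕ}
    {e : Batch} {row : List ℕ} (hc : ¬ a + 1 ≤ c) (he : e.Valid p n top rows caps a) :
    e.Valid p n top (row :: rows) (c :: caps) a := by
  refine ⟨?_, ?_, ?_, he.pairs, ?_⟩
  · simp [messages, hc, he.size]
  · rw [lanes_messages_cons_of_lt _ _ _ _ hc, he.ones]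
  · rw [lanes_messages_cons_of_lt _ _ _ _ hc, he.base]
    simp only [weight_zero_cons]
  · obtain ⟨T, hT, hT'⟩ := he.cols
    refine ⟨T, hT, fun i hi s hs => ?_⟩
    rw [lanes_messages_cons_of_lt _ _ _ _ hc, hT' i hi s hs]
    congr 2; funext v; simp [zeroLane, dot]


/-! ### Levels -/

structure LevelValid (p n top t : ℕ) (rows : List (List ℕ)) (caps : List ℕ) (l : List Batch) :
    Prop where
  length : l.length = t + 1
  valid : ∀ a ≤ t, (Batch.nth l a).Valid p n top rows caps a

def LevelsValid (p n top t : ℕ) : List (List ℕ) → List ℕ → List (List Batch) → Prop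
  | row :: rows, c :: caps, l :: ls =>
    LevelValid p n top t (row :: rows) (c :: caps) l ∧ LevelsValid p n top t rows caps ls
  | [], [], l :: _ => LevelValid p n top t [] [] l
  | _, _, _ => False

theorem length_stepLevel (p cap : ℕ) (row : List ℕ) (a : ℕ) (l : List Batch) :
    (stepLevel p cap row a l).length = l.length := by
  induction l generalizing a with
  | nil => rfl
  | cons e l ih =>
    cases l with
    | nil => rfl
    | cons e' l => rw [stepLevel, List.length_cons, ih, List.length_cons (a := e)]

theorem nth_stepLevel (p cap : ℕ) (row : List ℕ) (a i : ℕ) (l : List Batch) :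
    Batch.nth (stepLevel p cap row a l) i =
      if i + 1 < l.length ∧ a + i + 1 ≤ cap then combine p row (Batch.nth l i) (Batch.nth l (i + 1))
      else Batch.nth l i := by
  induction l generalizing a i with
  | nil => rfl
  | cons e l ih =>
    cases l with
    | nil => simp [stepLevel]
    | cons e' l =>
      cases i with
      | zero =>
        by_cases h : a + 1 ≤ cap
        · have : Nat.ble (a + 1) cap = true := Nat.ble_eq_true_of_le h
          simp [stepLevel, Batch.nth, h, this]
        · have : Nat.ble (a + 1) cap = false := by
            rw [← Bool.not_eq_true, Nat.ble_eq]; exact h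
          simp [stepLevel, Batch.nth, h, this]
      | succ i =>
        simp only [stepLevel, Batch.nth]
        rw [ih]
        simp only [List.length_cons, Batch.nth]
        congr 1
        rw [show a + 1 + i + 1 = a + (i + 1) + 1 by ring]
        simp

theorem nth_map_range (f : ℕ → Batch) (s N i : ℕ) (hi : i < N) :
    Batch.nth ((List.range' s N).map f) i = f (s + i) := by
  induction N generalizing s i with
  | zero => omega
  | succ N ih =>
    rw [List.range'_succ, List.map_cons]
    cases i with
    | zero => rfl
    | succ i => rw [Batch.nth, ih _ _ (by omega)]; congr 1; ring

theorem levelValid_baseLevel {p : ℕ} (hp : p ≤ 7) (n top t : ℕ) :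
    LevelValid p n top t [] [] (baseLevel n top t) := by
  refine ⟨by simp [baseLevel], fun a ha => ?_⟩
  rw [baseLevel, List.range_eq_range', nth_map_range _ _ _ _ (by omega), zero_add]
  refine ⟨rfl, rfl, ?_, rfl, fun _ => Tab.ofFn fun s => bif Nat.beq s 0 then 1 else 0, ?_, ?_⟩
  · simp [Batch.ofCols, messages, lanes, weight]
  · simp [Batch.ofCols, List.map_const']
  · intro c _ s hs
    rw [Tab.get_ofFn _ (by omega)]
    cases s with
    | zero => simp [messages, zeroLane, dot, lanes]
    | succ s =>
      have : (s + 1) % p ≠ 0 := by rw [Nat.mod_eq_of_lt hs]; omega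
      simp [messages, zeroLane, dot, lanes, this]
      rfl

theorem LevelsValid.head {p n top t : ℕ} {rows : List (List ℕ)} {caps : List ℕ}
    {ls : List (List Batch)} (h : LevelsValid p n top t rows caps ls) :
    LevelValid p n top t rows caps (headLevel ls) := by
  match rows, caps, ls with
  | _ :: _, _ :: _, _ :: _ => exact h.1
  | [], [], _ :: _ => exact h

theorem levelsValid_levels {p : ℕ} (hp : p ≤ 7) (hodd : p % 2 = 1) (n top t : ℕ)
    {rows : List (List ℕ)} {caps : List ℕ} (hrows : ∀ row ∈ rows, row.length = n)
    (hcaps : ∀ c ∈ caps, c ≤ t) (hlen : rows.length = caps.length) :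
    LevelsValid p n top t rows caps (levels p n top t rows caps) := by
  induction rows generalizing caps with
  | nil =>
    obtain rfl : caps = [] := List.length_eq_zero_iff.1 hlen.symm
    exact levelValid_baseLevel hp n top t
  | cons row rows ih =>
    obtain _ | ⟨c, caps⟩ := caps
    · simp at hlen
    have hl := ih (fun r hr => hrows r (List.mem_cons_of_mem _ hr))
      (fun c hc => hcaps c (List.mem_cons_of_mem _ hc)) (by simpa using hlen)
    refine ⟨⟨?_, fun a ha => ?_⟩, hl⟩
    · rw [length_stepLevel, hl.head.length]
    · rw [nth_stepLevel, hl.head.length, zero_add]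
      have hct : c ≤ t := hcaps c (by simp)
      split_ifs with h
      · exact (hl.head.valid a ha).combine hp hodd (hrows row (by simp)) h.2
          (hl.head.valid (a + 1) (by omega))
      · exact (hl.head.valid a ha).cons (by omega)

/-! ### Evaluation of a batch -/

theorem pack_eq (l : List ℕ) : pack l = Nat.ofDigits 1024 l := by
  induction l with
  | nil => rfl
  | cons x l ih =>
    rw [Nat.ofDigits_cons, ← ih]; rfl

theorem lookupSum_pairUp {α : Type} {p : ℕ} (hp : p ≤ 7) (hp0 : 0 < p) (T : α → Tab ℕ) (u : α → ℕ) :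
    ∀ (l : List α) (acc : ℕ), (∀ i ∈ l, u i < 1024) →
      lookupSum p (pairUp (l.map T)) (Nat.ofDigits 1024 (l.map u)) acc =
        acc + (l.map fun i => (T i).get (u i % p)).sum
  | [], _, _ => rfl
  | [i], acc, h => by
    have hi : u i < 1024 := h i (by simp)
    have hlt : ∀ x, x % p < 8 := fun x => lt_of_lt_of_le (Nat.mod_lt _ hp0) (by omega)
    simp only [List.map_cons, List.map_nil, Nat.ofDigits_singleton, pairUp, lookupSum, sel_eq,
      sel₂_eq]
    have e1 : Nat.mod (Nat.mod (u i) 1024) p = u i % p := by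
      have : u i % 1024 % p = u i % p := by rw [Nat.mod_eq_of_lt hi]
      exact this
    rw [e1, Tab.get_ofFn _ (hlt _), show ∀ a b : ℕ, Nat.mod a b = a % b from fun _ _ => rfl,
      show ∀ a b : ℕ, Nat.mod a b = a % b from fun _ _ => rfl, Tab.get_ofFn _ (hlt _)]
    simp
  | i :: j :: l, acc, h => by
    have hi : u i < 1024 := h i (by simp)
    have hj : u j < 1024 := h j (by simp)
    have hlt : ∀ x, x % p < 8 := fun x => lt_of_lt_of_le (Nat.mod_lt _ hp0) (by omega)
    have ih := lookupSum_pairUp hp hp0 T u l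
    simp only [List.map_cons, pairUp, lookupSum, sel_eq, sel₂_eq] at ih ⊢
    set X := Nat.ofDigits 1024 (l.map u) with hX
    have e : Nat.ofDigits 1024 (u i :: u j :: l.map u) = u i + 1024 * (u j + 1024 * X) := by
      simp [Nat.ofDigits_cons, hX]
    rw [e]
    have e1 : Nat.mod (u i + 1024 * (u j + 1024 * X)) 1024 = u i := by
      have : (u i + 1024 * (u j + 1024 * X)) % 1024 = u i := by omega
      exact this
    have e2 : Nat.mod (Nat.div (u i + 1024 * (u j + 1024 * X)) 1024) 1024 = u j := by
      have : (u i + 1024 * (u j + 1024 * X)) / 1024 % 1024 = u j := by omega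
      exact this
    have e3 : Nat.div (u i + 1024 * (u j + 1024 * X)) 1048576 = X := by
      have : (u i + 1024 * (u j + 1024 * X)) / 1048576 = X := by omega
      exact this
    rw [e1, e2, e3, ih _ fun k hk => h k (by simp [hk])]
    rw [show ∀ a b : ℕ, Nat.mod a b = a % b from fun _ _ => rfl,
      show ∀ a b : ℕ, Nat.mod a b = a % b from fun _ _ => rfl, Tab.get_ofFn _ (hlt _), Tab.get_ofFn _ (hlt _)]
    simp only [List.sum_cons, Nat.add_eq]
    ring

/-- The number of columns at which `u` plus the combination of `rows` given by `v` vanishes. -/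
def zeros (p n : ℕ) (rows : List (List ℕ)) (u : ℕ → ℕ) (v : List ℕ) : ℕ :=
  ((List.range n).map fun c => zeroLane p rows c (u c) v).sum

theorem zeros_le (p n : ℕ) (rows : List (List ℕ)) (u : ℕ → ℕ) (v : List ℕ) :
    zeros p n rows u v ≤ n := by
  have : zeros p n rows u v ≤ ((List.range n).map fun _ => 1).sum := by
    refine List.sum_le_sum fun c _ => ?_
    rw [zeroLane]; split_ifs <;> simp
  simpa using this

/-- Every admissible message `v` satisfies the bound on the number of zeros. -/
def Passes (p n top : ℕ) (rows : List (List ℕ)) (caps : List ℕ) (a : ℕ) (u : ℕ → ℕ) : Prop :=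
  ∀ v ∈ messages p caps a, top - (a + weight v) + zeros p n rows u v < 64

theorem passes_of_checkBatch {p n top : ℕ} (hp : p ≤ 7) (hp0 : 0 < p) (htop : top + n < 128)
    {rows : List (List ℕ)} {caps : List ℕ} {a : ℕ} {e : Batch} {u : ℕ → ℕ}
    (he : e.Valid p n top rows caps a) (hu : ∀ c < n, u c < 1024)
    (h : checkBatch p e (Nat.ofDigits 1024 ((List.range n).map u)) = true) :
    Passes p n top rows caps a u := by
  obtain ⟨T, hT, hT'⟩ := he.cols
  have h1 := Nat.eq_of_beq_eq_true h
  rw [he.pairs, hT, lookupSum_pairUp hp hp0 T u _ _ (by simpa using hu)] at h1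
  have h2 : ((List.range n).map fun c => (T c).get (u c % p)).sum =
      lanes ((messages p caps a).map fun v => zeros p n rows u v) := by
    unfold zeros
    rw [← sum_lanes_map]
    refine congrArg List.sum (List.map_congr_left fun c hc => ?_)
    rw [hT' c (by simpa using hc) _ (Nat.mod_lt _ hp0)]
    congr 2; funext v
    simp only [zeroLane, Nat.mod_add_mod]
  rw [h2, he.base, he.ones, lanes, lanes, ofDigits_map_add] at h1
  refine lt_of_land_lanes_eq_zero _ _ (fun v _ => ?_) h1
  have := zeros_le p n rows u v
  omega

theorem dot_zero_cons (v : List ℕ) (row : List ℕ) (rows : List (List ℕ)) (c : ℕ) :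
    dot (0 :: v) (row :: rows) c = dot v rows c := by simp [dot]

theorem zeros_zero_cons (p n : ℕ) (row : List ℕ) (rows : List (List ℕ)) (u : ℕ → ℕ) (v : List ℕ) :
    zeros p n (row :: rows) u (0 :: v) = zeros p n rows u v := by
  simp only [zeros, zeroLane, dot_zero_cons]

theorem zeros_cons (p n x : ℕ) (row : List ℕ) (rows : List (List ℕ)) (u : ℕ → ℕ) (v : List ℕ) :
    zeros p n (row :: rows) u (x :: v) =
      zeros p n rows (fun c => u c + x * row.getD c 0) v := by
  simp only [zeros, zeroLane, dot, add_assoc]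
  rfl

theorem Passes.cons {p n top : ℕ} {rows : List (List ℕ)} {caps : List ℕ} {a c : ℕ} {u : ℕ → ℕ}
    {row : List ℕ} (h : Passes p n top rows caps a u)
    (h' : a + 1 ≤ c → ∀ x ∈ List.range' 1 (p - 1),
      Passes p n top rows caps (a + 1) fun c => u c + x * row.getD c 0) :
    Passes p n top (row :: rows) (c :: caps) a u := by
  intro v hv
  rw [messages, List.mem_append, List.mem_map] at hv
  rcases hv with ⟨v, hv, rfl⟩ | hv
  · rw [weight_zero_cons, zeros_zero_cons]
    exact h v hv
  · split_ifs at hv with hc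
    · obtain ⟨x, hx, hv⟩ := List.mem_flatMap.1 hv
      obtain ⟨w, hw, rfl⟩ := List.mem_map.1 hv
      have hx0 : x ≠ 0 := by
        rw [List.mem_range'_1] at hx; omega
      rw [weight_cons hx0, zeros_cons, add_comm (weight w), ← add_assoc]
      exact h' hc x hx w hw
    · simp at hv

theorem ofDigits_add_mul_pack {n : ℕ} (u : ℕ → ℕ) {row : List ℕ} (hrow : row.length = n) (x : ℕ) :
    Nat.add (Nat.ofDigits 1024 ((List.range n).map u)) (Nat.mul x (pack row)) =
      Nat.ofDigits 1024 ((List.range n).map fun c => u c + x * row.getD c 0) := by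
  change Nat.ofDigits 1024 ((List.range n).map u) + x * pack row = _
  conv_lhs => rw [pack_eq, eq_map_getD hrow, ofDigits_map_mul, ofDigits_map_add]

theorem digit_step_lt {p x b L : ℕ} {row : List ℕ} (hp : p ≤ 7) (hx : x ∈ List.range' 1 (p - 1))
    (hrow : ∀ y ∈ row, y < 8) (hb : b + 42 * (L + 1) < 1024) (c : ℕ) :
    b + x * row.getD c 0 + 42 * L < 1024 := by
  have h1 : row.getD c 0 ≤ 7 := by
    rw [List.getD_eq_getElem?_getD]
    rcases lt_or_ge c row.length with h | h
    · rw [List.getElem?_eq_getElem h]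
      exact Nat.le_of_lt_succ (hrow _ (List.getElem_mem h))
    · rw [List.getElem?_eq_none h]; simp
  have h2 : x ≤ 6 := by rw [List.mem_range'_1] at hx; omega
  have := Nat.mul_le_mul h2 h1
  omega

structure RowsBounded (n : ℕ) (rows : List (List ℕ)) : Prop where
  length : ∀ row ∈ rows, row.length = n
  lt : ∀ row ∈ rows, ∀ y ∈ row, y < 8

theorem RowsBounded.tail {n : ℕ} {row : List ℕ} {rows : List (List ℕ)}
    (h : RowsBounded n (row :: rows)) : RowsBounded n rows :=
  ⟨fun r hr => h.length r (List.mem_cons_of_mem _ hr), fun r hr => h.lt r (List.mem_cons_of_mem _ hr)⟩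

theorem passes_of_checkTree {p n top t M : ℕ} (hp : p ≤ 7) (hp0 : 0 < p) (htop : top + n < 128) :
    ∀ (rows : List (List ℕ)) (caps : List ℕ) (ls : List (List Batch)) (a : ℕ) (u : ℕ → ℕ),
      RowsBounded n rows → LevelsValid p n top t rows caps ls → (∀ c ∈ caps, c ≤ t) → a ≤ t →
      (∀ c < n, u c + 42 * rows.length < 1024) →
      checkTree p M rows caps ls a (Nat.ofDigits 1024 ((List.range n).map u)) = true →
      Passes p n top rows caps a u
  | row :: rows, c :: caps, l :: ls, a, u, hr, hl, hc, ha, hu, h => by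
    rw [checkTree, Bool.cond_eq_ite] at h
    split_ifs at h with hM
    · exact passes_of_checkBatch hp hp0 htop (hl.1.valid a ha) (fun c hc => by have := hu c hc; omega) h
    · rw [Bool.and_eq_true, Bool.cond_eq_ite] at h
      have hc' : ∀ c ∈ caps, c ≤ t := fun c h => hc c (List.mem_cons_of_mem _ h)
      refine Passes.cons (passes_of_checkTree hp hp0 htop rows caps ls a u hr.tail hl.2 hc' ha
        (fun c hc => by have := hu c hc; simp only [List.length_cons] at this; omega) h.1) ?_
      intro hac x hx
      rw [if_pos (Nat.ble_eq_true_of_le hac)] at h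
      have hx' := List.all_eq_true.1 h.2 x hx
      rw [ofDigits_add_mul_pack u (hr.length row (by simp))] at hx'
      exact passes_of_checkTree hp hp0 htop rows caps ls (a + 1) _ hr.tail hl.2 hc'
        (hac.trans (hc c (by simp)))
        (fun c hc => digit_step_lt hp hx (hr.lt row (by simp)) (hu c hc) c) hx'
  | [], [], l :: ls, a, u, hr, hl, hc, ha, hu, h => by
    rw [checkTree.eq_def] at h
    exact passes_of_checkBatch hp hp0 htop (LevelValid.valid hl a ha) (fun c hc => by have := hu c hc; omega) h
  | [], _ :: _, _, _, _, _, hl, _, _, _, _ => by simp [LevelsValid] at hl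
  | _ :: _, [], _, _, _, _, hl, _, _, _, _ => by simp [LevelsValid] at hl
  | [], [], [], _, _, _, hl, _, _, _, _ => by simp [LevelsValid] at hl
  | _ :: _, _ :: _, [], _, _, _, hl, _, _, _, _ => by simp [LevelsValid] at hl

theorem passes_of_tasks {p n top t M : ℕ} (hp : p ≤ 7) (hp0 : 0 < p) (htop : top + n < 128) :
    ∀ (D : ℕ) (rows : List (List ℕ)) (caps : List ℕ) (ls : List (List Batch)) (a : ℕ) (u : ℕ → ℕ),
      RowsBounded n rows → LevelsValid p n top t rows caps ls → (∀ c ∈ caps, c ≤ t) → a ≤ t →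
      (∀ c < n, u c + 42 * rows.length < 1024) →
      (∀ b ∈ tasks p M D rows caps ls a (Nat.ofDigits 1024 ((List.range n).map u)), b = true) →
      Passes p n top rows caps a u
  | D + 1, row :: rows, c :: caps, l :: ls, a, u, hr, hl, hc, ha, hu, h => by
    rw [tasks, List.forall_mem_append, Bool.cond_eq_ite] at h
    have hc' : ∀ c ∈ caps, c ≤ t := fun c h => hc c (List.mem_cons_of_mem _ h)
    refine Passes.cons (passes_of_tasks hp hp0 htop D rows caps ls a u hr.tail hl.2 hc' ha
      (fun c hc => by have := hu c hc; simp only [List.length_cons] at this; omega) h.1) ?_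
    intro hac x hx
    rw [if_pos (Nat.ble_eq_true_of_le hac)] at h
    have hx' := fun b hb => h.2 b (List.mem_flatMap.2 ⟨x, hx, hb⟩)
    rw [ofDigits_add_mul_pack u (hr.length row (by simp))] at hx'
    exact passes_of_tasks hp hp0 htop D rows caps ls (a + 1) _ hr.tail hl.2 hc'
      (hac.trans (hc c (by simp)))
      (fun c hc => digit_step_lt hp hx (hr.lt row (by simp)) (hu c hc) c) hx'
  | 0, rows, caps, ls, a, u, hr, hl, hc, ha, hu, h => by
    refine passes_of_checkTree (M := M) hp hp0 htop rows caps ls a u hr hl hc ha hu (h _ ?_)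
    rw [tasks.eq_def]; simp
  | D + 1, [], caps, ls, a, u, hr, hl, hc, ha, hu, h => by
    refine passes_of_checkTree (M := M) hp hp0 htop [] caps ls a u hr hl hc ha hu (h _ ?_)
    rw [tasks.eq_def]; simp
  | _ + 1, _ :: _, [], _, _, _, _, hl, _, _, _, _ => by simp [LevelsValid] at hl
  | _ + 1, _ :: _, _ :: _, [], _, _, _, hl, _, _, _, _ => by simp [LevelsValid] at hl

/-- Up to scalars, every nonzero admissible message has `1` as its first nonzero symbol. -/
theorem bound_of_allTasks {p n top t M : ℕ} (hp : p ≤ 7) (hp1 : 1 < p) (htop : top + n < 128) :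
    ∀ (D : ℕ) (rows : List (List ℕ)) (caps : List ℕ) (ls : List (List Batch)),
      RowsBounded n rows → LevelsValid p n top t rows caps ls → (∀ c ∈ caps, c ≤ t) →
      42 * rows.length < 1024 → (∀ b ∈ allTasks p M D rows caps ls, b = true) →
      ∀ v ∈ messages p caps 0, v.find? (· ≠ 0) = some 1 →
        top - weight v + zeros p n rows (fun _ => 0) v < 64
  | D, row :: rows, c :: caps, l :: ls, hr, hl, hc, hlen, h, v, hv, hv1 => by
    rw [allTasks, List.forall_mem_append, Bool.cond_eq_ite] at h
    have hc' : ∀ c ∈ caps, c ≤ t := fun c h => hc c (List.mem_cons_of_mem _ h)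
    rw [messages, List.mem_append, List.mem_map] at hv
    simp only [List.length_cons] at hlen
    rcases hv with ⟨v, hv, rfl⟩ | hv
    · rw [weight_zero_cons, zeros_zero_cons]
      exact bound_of_allTasks hp hp1 htop (D - 1) rows caps ls hr.tail hl.2 hc' (by omega) h.2 v hv
        (by simpa using hv1)
    · split_ifs at hv with hc1
      · obtain ⟨x, hx, hv⟩ := List.mem_flatMap.1 hv
        obtain ⟨w, hw, rfl⟩ := List.mem_map.1 hv
        have hx0 : x ≠ 0 := by
          rw [List.mem_range'_1] at hx; omega
        obtain rfl : x = 1 := by simpa [hx0] using hv1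
        rw [if_pos (Nat.ble_eq_true_of_le (by omega))] at h
        have h1 := h.1
        have e : pack row = Nat.ofDigits 1024 ((List.range n).map fun c => 0 + 1 * row.getD c 0) := by
          rw [← ofDigits_add_mul_pack _ (hr.length row (by simp))]
          have : Nat.ofDigits 1024 ((List.range n).map fun _ => 0) = 0 := by
            simp
          rw [this]; simp
        rw [e] at h1
        have := passes_of_tasks (t := t) hp (by omega) htop _ rows caps ls 1 _ hr.tail hl.2 hc'
          (hc1.trans (hc c (by simp)))
          (fun c _ => digit_step_lt hp hx (hr.lt row (by simp)) (by omega) c) h1 w hw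
        rw [weight_cons hx0, zeros_cons, add_comm (weight w)]
        exact this
      · simp at hv
  | _, [], [], _, _, _, _, _, _, v, hv, hv1 => by
    obtain rfl : v = [] := by simpa [messages] using hv
    simp at hv1
  | _, [], _ :: _, _, _, hl, _, _, _, _, _, _ => by simp [LevelsValid] at hl
  | _, _ :: _, [], _, _, hl, _, _, _, _, _, _ => by simp [LevelsValid] at hl
  | _, _ :: _, _ :: _, [], _, hl, _, _, _, _, _, _ => by simp [LevelsValid] at hl

theorem forall_of_zipIdx_all {l : List Bool} {K : ℕ} (hK : 0 < K)
    (h : ∀ c < K, (l.zipIdx.all fun q => bif Nat.beq (q.2 % K) c then q.1 else true) = true) :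
    ∀ b ∈ l, b = true := by
  intro b hb
  obtain ⟨i, hi, rfl⟩ := List.getElem_of_mem hb
  have := List.all_eq_true.1 (h (i % K) (Nat.mod_lt _ hK)) (l[i], i)
    (by rw [List.mem_zipIdx_iff_getElem?]; simp [hi])
  simpa using this

theorem bound_of_chunks {p n top t M D K : ℕ} (hp : p ≤ 7) (hp1 : 1 < p) (hodd : p % 2 = 1)
    (htop : top + n < 128) (hK : 0 < K) {rows : List (List ℕ)} {caps : List ℕ}
    (hr : RowsBounded n rows) (hc : ∀ c ∈ caps, c ≤ t) (hlen : rows.length = caps.length)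
    (hlen' : rows.length ≤ 24) (h : ∀ c < K, chunk p n top t M D rows caps K c = true)
    {v : List ℕ} (hv : v ∈ messages p caps 0) (hv1 : v.find? (· ≠ 0) = some 1) :
    top - weight v + zeros p n rows (fun _ => 0) v < 64 :=
  bound_of_allTasks hp hp1 htop D rows caps _ hr
    (levelsValid_levels hp hodd n top t hr.length hc hlen) hc (by omega)
    (forall_of_zipIdx_all hK h) v hv hv1


/-! ### Quasi-twisted structure -/

section Rotation

variable {F : Type} [Field F] {m ℓ : ℕ}

theorem blockMatrix_one (g : Fin ℓ → List F) (i : Fin m) (q : Fin ℓ × Fin m) :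
    blockMatrix m 1 g i q = coeffVec m (g q.1) (q.2 - i) := by
  simp [blockMatrix, twistulant]

theorem comp_add_mem_blockCode [NeZero m] (g : Fin ℓ → List F) (r : Fin m)
    {c : Fin ℓ × Fin m → F} (hc : c ∈ blockCode m 1 g) :
    (fun q => c (q.1, q.2 + r)) ∈ blockCode m 1 g := by
  have : blockCode m 1 g ≤ (blockCode m 1 g).comap
      (LinearMap.funLeft F F fun q : Fin ℓ × Fin m => (q.1, q.2 + r)) := by
    refine Submodule.span_le.2 ?_
    rintro _ ⟨i, rfl⟩
    refine Submodule.subset_span ⟨i - r, ?_⟩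
    funext q
    rw [LinearMap.funLeft_apply, blockMatrix_one, blockMatrix_one]
    congr 1
    exact sub_sub_eq_add_sub _ _ _
  exact this hc

theorem isQuasiTwisted_interleave_blockCode [NeZero m] (hℓ : 0 < ℓ) (g : Fin ℓ → List F) :
    IsQuasiTwisted ℓ 1 (interleave (blockCode m 1 g)) := by
  refine ⟨one_ne_zero, hℓ, Dvd.intro_left m rfl, ?_⟩
  rintro _ ⟨c, hc, rfl⟩
  refine ⟨_, comp_add_mem_blockCode g (-1) hc, ?_⟩
  have hm : 0 < m := NeZero.pos m
  funext s
  simp only [LinearMap.funLeft_apply, constaShift, one_mul]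
  have hs := s.isLt
  have hn : m * ℓ = (m - 1) * ℓ + ℓ := by
    rw [← Nat.succ_mul, Nat.succ_eq_add_one, Nat.sub_add_cancel hm]
  split_ifs with h
  · have e : (s + (m * ℓ - ℓ)) % (m * ℓ) = s + (m - 1) * ℓ := by
      rw [Nat.mod_eq_of_lt] <;> omega
    congr 2
    · ext
      simp [Fin.modNat, e]
    · rw [← sub_eq_add_neg, sub_eq_iff_eq_add]
      ext
      have h0 : (s : ℕ) / ℓ = 0 := Nat.div_eq_of_lt h
      simp only [Fin.divNat, e, Nat.add_mul_div_right _ _ hℓ, h0, Fin.val_add, zero_add, Fin.val_one']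
      rw [Nat.add_mod_mod, Nat.sub_add_cancel hm, Nat.mod_self]
  · have e : (s : ℕ) = (s - ℓ) + ℓ := by omega
    congr 2
    · ext
      simp only [Fin.modNat]
      conv_lhs => rw [e, Nat.add_mod_right]
    · rw [← sub_eq_add_neg, sub_eq_iff_eq_add]
      ext
      have h1 : (s : ℕ) / ℓ = (s - ℓ) / ℓ + 1 := by
        conv_lhs => rw [e, Nat.add_div_right _ hℓ]
      have h2 : (s : ℕ) / ℓ < m := Nat.div_lt_of_lt_mul (hs.trans_eq (mul_comm _ _))
      simp only [Fin.divNat, Fin.val_add, Fin.val_one', Nat.add_mod_mod]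
      rw [← h1, Nat.mod_eq_of_lt h2]

end Rotation

/-! ### Coordinates in interleaved order -/

section Coord

variable {F : Type} {m ℓ : ℕ} [NeZero m] [NeZero ℓ]

/-- The coordinate at the position `s` of the interleaved word, continued periodically. -/
def coord (c : Fin ℓ × Fin m → F) (s : ℕ) : F := c (Fin.ofNat ℓ s, Fin.ofNat m (s / ℓ))

theorem coord_add_mul (c : Fin ℓ × Fin m → F) (s r : ℕ) :
    coord (fun q => c (q.1, q.2 + Fin.ofNat m r)) s = coord c (s + r * ℓ) := by
  have hℓ : 0 < ℓ := NeZero.pos ℓ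
  simp only [coord]
  congr 2
  · ext; simp [Fin.ofNat]
  · ext; simp [Fin.ofNat, Fin.val_add, Nat.add_mul_div_right _ _ hℓ]

theorem coord_periodic (c : Fin ℓ × Fin m → F) (s : ℕ) : coord c (s + m * ℓ) = coord c s := by
  rw [← coord_add_mul]
  simp [Fin.ofNat, coord]

theorem coord_mul_add (c : Fin ℓ × Fin m → F) (b : Fin ℓ) (j : Fin m) :
    coord c (j * ℓ + b) = c (b, j) := by
  have hℓ : 0 < ℓ := NeZero.pos ℓ
  simp only [coord]
  congr 2
  · ext; simp [Fin.ofNat, Nat.mod_eq_of_lt b.isLt]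
  · ext
    simp [Fin.ofNat, mul_comm, Nat.mul_add_div hℓ, Nat.div_eq_of_lt b.isLt, Nat.mod_eq_of_lt j.isLt]

variable [Field F]

theorem eq_zero_of_coord {c : Fin ℓ × Fin m → F} (h : ∀ s < m * ℓ, coord c s = 0) : c = 0 := by
  funext ⟨b, j⟩
  rw [← coord_mul_add c b j, h _ ?_]
  · rfl
  · calc (j : ℕ) * ℓ + b < j * ℓ + ℓ := by omega
      _ = (j + 1) * ℓ := by ring
      _ ≤ m * ℓ := Nat.mul_le_mul_right _ j.isLt

theorem sum_range_mul (f : ℕ → ℕ) (m ℓ : ℕ) :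
    ∑ s ∈ Finset.range (m * ℓ), f s = ∑ j ∈ Finset.range m, ∑ b ∈ Finset.range ℓ, f (j * ℓ + b) := by
  induction m with
  | zero => simp
  | succ m ih => rw [Nat.succ_mul, Finset.sum_range_add, ih, Finset.sum_range_succ]

variable [DecidableEq F]

/-- The indicator of the support in interleaved order. -/
def nz (c : Fin ℓ × Fin m → F) (s : ℕ) : ℕ := if coord c s = 0 then 0 else 1

theorem hammingNorm_eq_sum (c : Fin ℓ × Fin m → F) :
    hammingNorm c = ∑ s ∈ Finset.range (m * ℓ), nz c s := by
  rw [sum_range_mul, hammingNorm, Finset.card_filter, Fintype.sum_prod_type_right,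
    ← Fin.sum_univ_eq_sum_range (fun j => ∑ b ∈ Finset.range ℓ, nz c (j * ℓ + b)) m]
  refine Finset.sum_congr rfl fun j _ => ?_
  rw [← Fin.sum_univ_eq_sum_range (fun b => nz c (j * ℓ + b)) ℓ]
  refine Finset.sum_congr rfl fun b _ => ?_
  rw [nz, coord_mul_add]
  split_ifs <;> simp_all

end Coord

/-- The cycle lemma: a periodic sequence of total weight at most `T` has a rotation all of whose
prefixes have at most the average weight. -/
theorem exists_rotation_sum_le {m ℓ T : ℕ} (hm : 0 < m) (f : ℕ → ℕ)
    (hf : ∀ s, f (s + m * ℓ) = f s) (hT : ∑ s ∈ Finset.range (m * ℓ), f s ≤ T) :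
    ∃ r, ∀ i ≤ m, m * ∑ s ∈ Finset.range (i * ℓ), f (s + r * ℓ) ≤ i * T := by
  set P : ℕ → ℕ := fun i => ∑ s ∈ Finset.range (i * ℓ), f s with hP
  have hPm : ∀ i, P (m + i) = P m + P i := by
    intro i
    simp only [hP]
    rw [add_mul, Finset.sum_range_add]
    congr 1
    exact Finset.sum_congr rfl fun s _ => by rw [add_comm, hf]
  obtain ⟨r, hr, hmax⟩ := Finset.exists_max_image (Finset.range m)
    (fun i => (m * P i : ℤ) - i * T) ⟨0, by simpa using hm⟩
  refine ⟨r, fun i hi => ?_⟩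
  have hsum : P (r + i) = P r + ∑ s ∈ Finset.range (i * ℓ), f (s + r * ℓ) := by
    simp only [hP]
    rw [add_mul, Finset.sum_range_add]
    congr 1
    exact Finset.sum_congr rfl fun s _ => by rw [add_comm]
  have key : (m * P (r + i) : ℤ) - (r + i) * T ≤ m * P r - r * T := by
    rcases lt_or_ge (r + i) m with h | h
    · exact_mod_cast hmax (r + i) (Finset.mem_range.2 h)
    · obtain ⟨t, ht⟩ := Nat.exists_eq_add_of_le h
      have h1 := hmax t (Finset.mem_range.2 (by rw [Finset.mem_range] at hr; omega))
      have h2 : (m : ℤ) * P m ≤ m * T := by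
        have : m * P m ≤ m * T := Nat.mul_le_mul_left _ hT
        exact_mod_cast this
      have h3 : (r : ℤ) + i = m + t := by exact_mod_cast ht
      rw [ht, hPm, h3]
      push_cast at h1 ⊢
      linarith
  rw [hsum] at key
  zify
  push_cast at key ⊢
  linarith

/-! ### Codewords and messages -/

theorem mem_messages {p : ℕ} (x cap : ℕ → ℕ) (N s a : ℕ) (hx : ∀ i, x i < p)
    (h : ∀ i < N, a + ∑ t ∈ Finset.range (i + 1), (if x (s + t) = 0 then 0 else 1) ≤ cap (s + i)) :
    (List.range' s N).map x ∈ messages p ((List.range' s N).map cap) a := by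
  induction N generalizing s a with
  | zero => simp [messages]
  | succ N ih =>
    rw [List.range'_succ, List.map_cons, List.map_cons, messages, List.mem_append]
    by_cases h0 : x s = 0
    · left
      rw [h0]
      refine List.mem_map_of_mem (ih _ _ fun i hi => ?_)
      have := h (i + 1) (by omega)
      rw [Finset.sum_range_succ', add_zero, if_pos h0, add_zero] at this
      simpa only [add_assoc, add_comm 1] using this
    · right
      have hs := h 0 (by omega)
      simp only [zero_add, Finset.sum_range_one, add_zero, if_neg h0] at hs
      rw [if_pos hs]
      refine List.mem_flatMap.2 ⟨x s, ?_, List.mem_map_of_mem (ih _ _ fun i hi => ?_)⟩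
      · rw [List.mem_range'_1]
        have := hx s
        omega
      · have := h (i + 1) (by omega)
        rw [Finset.sum_range_succ', add_zero, if_neg h0] at this
        simpa only [add_assoc, add_comm 1] using this

theorem weight_map_range (x : ℕ → ℕ) (k : ℕ) :
    weight ((List.range k).map x) = ∑ t ∈ Finset.range k, if x t = 0 then 0 else 1 := by
  induction k with
  | zero => rfl
  | succ k ih =>
    rw [List.range_succ, Finset.sum_range_succ, ← ih, weight, weight, List.map_append,
      List.countP_append]
    congr 1
    by_cases h : x k = 0 <;> simp [h]

theorem dot_eq_sum {v : List ℕ} {rows : List (List ℕ)} (h : v.length = rows.length) (c : ℕ) :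
    dot v rows c = ∑ i ∈ Finset.range v.length, v.getD i 0 * (rows.getD i []).getD c 0 := by
  induction v generalizing rows with
  | nil => rfl
  | cons x v ih =>
    obtain _ | ⟨row, rows⟩ := rows
    · simp at h
    · rw [dot, ih (by simpa using h), List.length_cons, Finset.sum_range_succ', add_comm]
      simp


section Systematic

variable {p m ℓ : ℕ} [Fact p.Prime] [NeZero m] [NeZero ℓ]

/-- The entry at the interleaved position `s` of the row `i` of the block matrix, as a number. -/
def digit (m : ℕ) (g : Fin ℓ → List (ZMod p)) (i s : ℕ) : ℕ :=
  ((g (Fin.ofNat ℓ s)).getD ((m - i + s / ℓ) % m) 0).val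

/-- In every row of the block matrix, the coordinates from `k` on are the combination of `rows`
given by the first `k` coordinates. -/
def checkSystematic (m : ℕ) (g : Fin ℓ → List (ZMod p)) (k : ℕ) (rows : List (List ℕ)) : Bool :=
  (List.range m).all fun i => (List.range (m * ℓ - k)).all fun t =>
    Nat.beq (digit m g i (k + t)) (dot ((List.range k).map (digit m g i)) rows t % p)

/-- The rows of `inv` are the coefficients of combinations of the first `k` rows of the block matrix
whose first `k` coordinates are the unit vectors. -/
def checkInverse (m : ℕ) (g : Fin ℓ → List (ZMod p)) (k : ℕ) (inv : List (List ℕ)) : Bool :=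
  (List.range k).all fun i => (List.range k).all fun j =>
    Nat.beq (dot (inv.getD i []) ((List.range k).map fun r => (List.range k).map (digit m g r)) j % p)
      (bif Nat.beq i j then 1 else 0)

theorem coord_blockMatrix (g : Fin ℓ → List (ZMod p)) (i : Fin m) (s : ℕ) :
    coord (blockMatrix m 1 g i) s = (digit m g i s : ZMod p) := by
  rw [coord, blockMatrix_one, digit, ZMod.natCast_zmod_val, coeffVec]
  congr 1
  simp [Fin.sub_def]

theorem coord_add (c c' : Fin ℓ × Fin m → ZMod p) (s : ℕ) : coord (c + c') s = coord c s + coord c' s :=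
  rfl

theorem coord_smul (u : ZMod p) (c : Fin ℓ × Fin m → ZMod p) (s : ℕ) :
    coord (u • c) s = u * coord c s := rfl

theorem coord_sum {ι : Type} (I : Finset ι) (c : ι → Fin ℓ × Fin m → ZMod p) (s : ℕ) :
    coord (∑ i ∈ I, c i) s = ∑ i ∈ I, coord (c i) s := by
  simp [coord, Finset.sum_apply]

/-- The message of a codeword. -/
def message (k : ℕ) (c : Fin ℓ × Fin m → ZMod p) : List ℕ :=
  (List.range k).map fun s => (coord c s).val

theorem natCast_dot_map {k : ℕ} (x : ℕ → ℕ) {rows : List (List ℕ)} (h : rows.length = k) (t : ℕ) :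
    (dot ((List.range k).map x) rows t : ZMod p) =
      ∑ i ∈ Finset.range k, (x i : ZMod p) * ((rows.getD i []).getD t 0 : ℕ) := by
  rw [dot_eq_sum (by simp [h])]
  push_cast
  rw [List.length_map, List.length_range]
  refine Finset.sum_congr rfl fun i hi => ?_
  have hi : i < k := Finset.mem_range.1 hi
  simp [hi]

/-- The linear relations satisfied by the coordinates of the codewords. -/
theorem coord_eq_dot {g : Fin ℓ → List (ZMod p)} {k : ℕ} {rows : List (List ℕ)}
    (hlen : rows.length = k) (h : checkSystematic m g k rows = true) {c : Fin ℓ × Fin m → ZMod p}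
    (hc : c ∈ blockCode m 1 g) {t : ℕ} (ht : t < m * ℓ - k) :
    coord c (k + t) = (dot (message k c) rows t : ZMod p) := by
  have key : ∀ c ∈ blockCode m 1 g, coord c (k + t) =
      ∑ i ∈ Finset.range k, coord c i * ((rows.getD i []).getD t 0 : ℕ) := by
    intro c hc
    induction hc using Submodule.span_induction with
    | mem c hc =>
      obtain ⟨i, rfl⟩ := hc
      have h1 := List.all_eq_true.1 (List.all_eq_true.1 h i (by simp)) t (by simpa using ht)
      have h2 := Nat.eq_of_beq_eq_true h1
      rw [coord_blockMatrix, h2, ZMod.natCast_mod, natCast_dot_map _ hlen]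
      simp only [coord_blockMatrix]
    | zero => simp [coord]
    | add c c' _ _ hc hc' => simp only [coord_add, hc, hc', add_mul, Finset.sum_add_distrib]
    | smul u c _ hc => simp only [coord_smul, hc, Finset.mul_sum, mul_assoc]
  rw [key c hc, message, natCast_dot_map _ hlen]
  simp

theorem exists_mem_blockCode_coord {g : Fin ℓ → List (ZMod p)} {k : ℕ} {inv : List (List ℕ)}
    (hk : k ≤ m) (hinv : ∀ i < k, (inv.getD i []).length = k) (h : checkInverse m g k inv = true)
    (x : ℕ → ZMod p) : ∃ c ∈ blockCode m 1 g, ∀ j < k, coord c j = x j := by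
  refine ⟨∑ i ∈ Finset.range k, x i • ∑ r ∈ Finset.range k,
    ((inv.getD i []).getD r 0 : ZMod p) • blockMatrix m 1 g (Fin.ofNat m r), ?_, fun j hj => ?_⟩
  · exact Submodule.sum_mem _ fun i _ => Submodule.smul_mem _ _ (Submodule.sum_mem _ fun r _ =>
      Submodule.smul_mem _ _ (Submodule.subset_span ⟨_, rfl⟩))
  · have key : ∀ i < k, coord (∑ r ∈ Finset.range k, ((inv.getD i []).getD r 0 : ZMod p) •
        blockMatrix m 1 g (Fin.ofNat m r)) j = if i = j then 1 else 0 := by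
      intro i hi
      have h1 := List.all_eq_true.1 (List.all_eq_true.1 h i (by simpa using hi)) j (by simpa using hj)
      have h2 := congrArg (Nat.cast : ℕ → ZMod p) (Nat.eq_of_beq_eq_true h1)
      rw [ZMod.natCast_mod, dot_eq_sum (by rw [hinv i hi]; simp), hinv i hi] at h2
      have h3 : ((bif Nat.beq i j then 1 else 0 : ℕ) : ZMod p) = if i = j then 1 else 0 := by
        by_cases hij : i = j
        · simp [hij]
        · rw [if_neg hij, show Nat.beq i j = false from
            Bool.eq_false_iff.2 fun hb => hij (Nat.eq_of_beq_eq_true hb)]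
          simp
      rw [← h3, ← h2, coord_sum]
      push_cast
      refine Finset.sum_congr rfl fun r hr => ?_
      have hr : r < k := Finset.mem_range.1 hr
      rw [coord_smul, coord_blockMatrix]
      simp [hr, hj, Nat.mod_eq_of_lt (hr.trans_le hk)]
    rw [coord_sum]
    simp only [coord_smul]
    rw [Finset.sum_congr rfl fun i hi => by rw [key i (Finset.mem_range.1 hi)]]
    simp [hj]

theorem coord_eq_zero_of_message {g : Fin ℓ → List (ZMod p)} {k : ℕ} {rows : List (List ℕ)}
    (hlen : rows.length = k) (h : checkSystematic m g k rows = true) {c : Fin ℓ × Fin m → ZMod p}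
    (hc : c ∈ blockCode m 1 g) (h0 : ∀ s < k, coord c s = 0) : c = 0 := by
  refine eq_zero_of_coord fun s hs => ?_
  rcases lt_or_ge s k with hsk | hsk
  · exact h0 s hsk
  · obtain ⟨t, rfl⟩ := Nat.exists_eq_add_of_le hsk
    rw [coord_eq_dot hlen h hc (by omega), message, natCast_dot_map _ hlen]
    refine Finset.sum_eq_zero fun i hi => ?_
    rw [h0 i (Finset.mem_range.1 hi)]
    simp

theorem finrank_blockCode {g : Fin ℓ → List (ZMod p)} {k : ℕ} {rows inv : List (List ℕ)}
    (hk : k ≤ m) (hlen : rows.length = k) (h : checkSystematic m g k rows = true)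
    (hinv : ∀ i < k, (inv.getD i []).length = k) (h' : checkInverse m g k inv = true) :
    Module.finrank (ZMod p) (blockCode m 1 g) = k := by
  let φ : (Fin ℓ × Fin m → ZMod p) →ₗ[ZMod p] (Fin k → ZMod p) :=
    LinearMap.funLeft _ _ fun s => (Fin.ofNat ℓ s, Fin.ofNat m (s / ℓ))
  have hφ : ∀ c s, φ c s = coord c s := fun _ _ => rfl
  have hbij : Function.Bijective (φ.domRestrict (blockCode m 1 g)) := by
    constructor
    · rw [injective_iff_map_eq_zero]
      rintro ⟨c, hc⟩ h0
      have := coord_eq_zero_of_message hlen h hc fun s hs => congrFun h0 ⟨s, hs⟩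
      simpa using this
    · intro y
      obtain ⟨c, hc, hy⟩ := exists_mem_blockCode_coord hk hinv h' fun s =>
        if hs : s < k then y ⟨s, hs⟩ else 0
      refine ⟨⟨c, hc⟩, funext fun s => ?_⟩
      rw [LinearMap.domRestrict_apply, hφ, hy s s.isLt, dif_pos s.isLt]
  rw [(LinearEquiv.ofBijective _ hbij).finrank_eq]
  simp

theorem hammingNorm_add_zeros {g : Fin ℓ → List (ZMod p)} {k : ℕ} {rows : List (List ℕ)}
    (hk : k ≤ m * ℓ) (hlen : rows.length = k) (h : checkSystematic m g k rows = true)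
    {c : Fin ℓ × Fin m → ZMod p} (hc : c ∈ blockCode m 1 g) :
    hammingNorm c + zeros p (m * ℓ - k) rows (fun _ => 0) (message k c) =
      weight (message k c) + (m * ℓ - k) := by
  have h1 : zeros p (m * ℓ - k) rows (fun _ => 0) (message k c) =
      ∑ t ∈ Finset.range (m * ℓ - k), if coord c (k + t) = 0 then 1 else 0 := by
    rw [zeros, Finset.sum_range, ← List.sum_ofFn, List.ofFn_eq_map, ← List.map_coe_finRange_eq_range,
      List.map_map]
    refine congrArg List.sum (List.map_congr_left fun t _ => ?_)
    rw [coord_eq_dot hlen h hc t.isLt, Function.comp_apply, zeroLane, zero_add]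
    simp only [ZMod.natCast_eq_zero_iff, Nat.dvd_iff_mod_eq_zero]
  have h2 : weight (message k c) = ∑ s ∈ Finset.range k, nz c s := by
    rw [message, weight_map_range]
    simp only [nz, ZMod.val_eq_zero]
  have h3 := hammingNorm_eq_sum c
  rw [← Nat.add_sub_cancel' hk, Finset.sum_range_add] at h3
  rw [h3, h1, h2, add_assoc, ← Finset.sum_add_distrib]
  congr 1
  have : ∀ t, nz c (k + t) + (if coord c (k + t) = 0 then 1 else 0) = 1 := by
    intro t; rw [nz]; split_ifs <;> rfl
  simp [this]

end Systematic

/-- The bounds for the prefix weights of the messages of suitably rotated words of weight less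
than `d`. -/
def weightCaps (m ℓ k d : ℕ) : List ℕ := (List.range k).map fun s => (s / ℓ + 1) * (d - 1) / m

theorem exists_normalized_of_hammingNorm_lt {p m ℓ : ℕ} [Fact p.Prime] [NeZero m] [NeZero ℓ]
    {g : Fin ℓ → List (ZMod p)} {k d : ℕ} {rows : List (List ℕ)} (hk : k ≤ m * ℓ)
    (hlen : rows.length = k) (h : checkSystematic m g k rows = true) {c : Fin ℓ × Fin m → ZMod p}
    (hc : c ∈ blockCode m 1 g) (h0 : c ≠ 0) (hd : hammingNorm c < d) :
    ∃ c' ∈ blockCode m 1 g, hammingNorm c' = hammingNorm c ∧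
      message k c' ∈ messages p (weightCaps m ℓ k d) 0 ∧ (message k c').find? (· ≠ 0) = some 1 := by
  have hm : 0 < m := NeZero.pos m
  have hℓ : 0 < ℓ := NeZero.pos ℓ
  have hp1 : Fact (1 < p) := ⟨(Fact.out : p.Prime).one_lt⟩
  have hper : ∀ s, nz c (s + m * ℓ) = nz c s := fun s => by rw [nz, coord_periodic, nz]
  obtain ⟨r, hr⟩ := exists_rotation_sum_le hm (nz c) hper
    (hammingNorm_eq_sum c ▸ Nat.le_sub_one_of_lt hd)
  set c₁ : Fin ℓ × Fin m → ZMod p := fun q => c (q.1, q.2 + Fin.ofNat m r) with hc₁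
  have hmem : c₁ ∈ blockCode m 1 g := comp_add_mem_blockCode g _ hc
  have hcoord : ∀ s, coord c₁ s = coord c (s + r * ℓ) := fun s => coord_add_mul c s r
  have hnorm : hammingNorm c₁ = hammingNorm c := by
    rw [hammingNorm, hammingNorm]
    refine Finset.card_equiv ((Equiv.refl _).prodCongr (Equiv.addRight (Fin.ofNat m r))) fun q => ?_
    simp only [Finset.mem_filter_univ]
    rfl
  have hne : c₁ ≠ 0 := by
    rw [← hammingNorm_ne_zero_iff, hnorm, hammingNorm_ne_zero_iff]; exact h0
  have hex : ∃ s, s < k ∧ coord c₁ s ≠ 0 := by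
    by_contra! hcon
    exact hne (coord_eq_zero_of_message hlen h hmem hcon)
  classical
  obtain ⟨hsk, hs0⟩ := Nat.find_spec hex
  have hmin := fun t (ht : t < Nat.find hex) => Nat.find_min hex ht
  set f := Nat.find hex
  have hu : (coord c₁ f)⁻¹ ≠ 0 := inv_ne_zero hs0
  set c₂ := (coord c₁ f)⁻¹ • c₁ with hc₂
  have hcoord₂ : ∀ s, coord c₂ s = (coord c₁ f)⁻¹ * coord c₁ s := fun s => coord_smul _ _ s
  have hz : ∀ s, coord c₂ s = 0 ↔ coord c₁ s = 0 := fun s => by simp [hcoord₂, hs0]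
  refine ⟨c₂, Submodule.smul_mem _ _ hmem, ?_, ?_, ?_⟩
  · rw [← hnorm]
    exact hammingNorm_smul (fun _ _ _ h => mul_left_cancel₀ hu h) _
  · rw [message, weightCaps, List.range_eq_range']
    refine mem_messages _ _ _ _ _ (fun s => ZMod.val_lt _) fun i hi => ?_
    have hi' : i / ℓ + 1 ≤ m := Nat.div_lt_of_lt_mul ((hi.trans_le hk).trans_eq (mul_comm _ _))
    rw [Nat.le_div_iff_mul_le hm, zero_add, zero_add, mul_comm _ m]
    refine le_trans (Nat.mul_le_mul_left _ ?_) (hr _ hi')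
    simp only [zero_add, ZMod.val_eq_zero, hz, hcoord]
    refine Finset.sum_le_sum_of_subset (Finset.range_subset_range.2 ?_)
    have := Nat.lt_mul_div_succ i hℓ
    rw [mul_comm]
    exact this
  · rw [message, List.find?_map]
    have : (List.range k).find? ((fun x : ℕ => decide (x ≠ 0)) ∘ fun s => (coord c₂ s).val) = some f := by
      rw [List.find?_range_eq_some]
      refine ⟨?_, by simpa using hsk, fun t ht => ?_⟩
      · simp [hz, hs0]
      · have := hmin t ht
        simp only [not_and, not_not] at this
        simp [hz, this (by omega)]
    rw [this, Option.map_some, hcoord₂, inv_mul_cancel₀ hs0, ZMod.val_one]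

/-- The parameters of a code from the outcome of the exhaustive search. -/
theorem hasParameters_of_chunks {p m ℓ n r k d t top M D K : ℕ} [Fact p.Prime] [NeZero m] [NeZero ℓ]
    {g : Fin ℓ → List (ZMod p)} {rows inv : List (List ℕ)} {light caps : List ℕ}
    (hp : p ≤ 7 ∧ p % 2 = 1) (hn : m * ℓ = n) (hr : n - k = r) (hkm : k ≤ m) (hk : k ≤ 24)
    (hd : 0 < d ∧ d ≤ 64 ∧ n ≤ 63 + d) (htop : k + (63 + d - n) = top) (hK : 0 < K)
    (hlen : rows.length = k) (hrows : RowsBounded r rows)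
    (hinv : ∀ i < k, (inv.getD i []).length = k) (hlight : light.length = k)
    (hlight' : ∀ x ∈ light, x < p) (hcaps : weightCaps m ℓ k d = caps) (hcaps' : ∀ c ∈ caps, c ≤ t)
    (hS : checkSystematic m g k rows = true) (hI : checkInverse m g k inv = true)
    (hL : weight light + r = d + zeros p r rows (fun _ => 0) light)
    (h : ∀ c < K, chunk p r top t M D rows caps K c = true) :
    HasParameters (blockCode m 1 g) n k d := by
  subst hn hr htop hcaps
  have hkn : k ≤ m * ℓ := hkm.trans (Nat.le_mul_of_pos_right _ (NeZero.pos ℓ))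
  refine ⟨by simp [mul_comm], finrank_blockCode hkm hlen hS hinv hI, ?_, ?_⟩
  · obtain ⟨c, hc, hcx⟩ := exists_mem_blockCode_coord hkm hinv hI fun s => (light.getD s 0 : ZMod p)
    have hmsg : message k c = light := by
      rw [eq_map_getD hlight, message]
      refine List.map_congr_left fun s hs => ?_
      have hs : s < k := by simpa using hs
      rw [hcx s hs, ZMod.val_natCast, Nat.mod_eq_of_lt]
      have : s < light.length := hlight ▸ hs
      rw [List.getD_eq_getElem _ _ this]
      exact hlight' _ (List.getElem_mem this)
    have hnorm : hammingNorm c = d := by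
      have := hammingNorm_add_zeros hkn hlen hS hc
      rw [hmsg] at this
      omega
    refine ⟨c, hc, 0, Submodule.zero_mem _, ?_, ?_⟩
    · rw [← hammingNorm_ne_zero_iff]; omega
    · rw [hammingDist_zero_right, hnorm]
  · rintro w ⟨x, hx, y, hy, hxy, rfl⟩
    rw [hammingDist_comm, hammingDist_eq_hammingNorm, neg_add_eq_sub]
    by_contra! hlt
    obtain ⟨c, hc, hcn, hmem, hone⟩ := exists_normalized_of_hammingNorm_lt hkn hlen hS
      (Submodule.sub_mem _ hx hy) (sub_ne_zero.2 hxy) hlt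
    have h1 := bound_of_chunks hp.1 (Fact.out : p.Prime).one_lt hp.2 (by omega) hK hrows hcaps'
      (by simp [weightCaps, hlen]) (by omega) h hmem hone
    have h2 := hammingNorm_add_zeros hkn hlen hS hc
    have h3 : weight (message k c) ≤ k := by
      refine List.countP_le_length.trans_eq ?_
      simp [message]
    omega


/-! ### The five codes -/

/-- The redundancy part of the systematic generator matrix of the code of length 85. -/
def rows85 : List (List ℕ) :=
  ([4219000750036871966119087708678431268691936578160556337669217,
     113716298472759631616339963921513319441835401219680098728391683,
     51422146948608052728616657945988299359576482540113481031100168,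
     104554154916014935216062670451187695081091341983155043878121561,
     110499197034803349083781141638055371147312673213983021901420172,
     62683952069008593669816287249979841886776665424933542879695426,
     28997490461765693074856362709838502408642262456430075247178458,
     58473562904384026656307485285121721345308198737997758479284314,
     26585316580518065467856157634340699947459317011966533315961939,
     106919865055822546715214231001906802990104874449931459331634692,
     90196514656487372270250390242982464655176136978323332450625042,
     55146045227897291942589015927312530442666832830729398496831780,
     107441367524842909262805220024141401648047110041539026865956000,
     13021212043803419736087368101069392427430194187232056555116160,
     109783412260456418079801211000266696008280685908807906912945812,
     54736343259765256774609181524526955477457605089035040475353865]).map (unpack 69)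

/-- The coefficients of the systematic generator matrix of the code of length 85 in terms of
the first rows of the block matrix. -/
def inverse85 : List (List ℕ) :=
  ([106661408707675, 80024401195210, 120701794231836, 149619632840963, 89087307233282,
     155263613375747, 155187102746338, 45082196592651, 158641212687363, 110099763635347,
     10997702169225, 72776543942680, 155206195418251, 53003323768856, 5535594324035,
     146810759681697]).map (unpack 16)

/-- The message of a codeword of minimum weight of the code of length 85. -/
def light85 : List ℕ := [0, 3, 3, 2, 1, 0, 0, 0, 0, 0, 0, 3, 2, 0, 2, 0]

/-- The bounds for the prefix weights of the messages of the code of length 85. -/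
def caps85 : List ℕ := [2, 2, 2, 2, 2, 5, 5, 5, 5, 5, 7, 7, 7, 7, 7, 10]

theorem checkSystematic_g85 : checkSystematic 17 g85 16 rows85 = true := by decide +kernel

theorem checkInverse_g85 : checkInverse 17 g85 16 inverse85 = true := by decide +kernel

theorem chunk_g85 :
    ∀ c < 3, chunk 5 69 39 10 200000 5 rows85 caps85 3 c = true := by
  intro c hc
  interval_cases c <;> decide +kernel

theorem hasParameters_g85 : HasParameters (blockCode 17 1 g85) 85 16 45 := by
  refine hasParameters_of_chunks (rows := rows85) (inv := inverse85) (light := light85)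
    (caps := caps85) (t := 10) (M := 200000) (D := 5) (K := 3) (by decide) rfl rfl (by decide)
    (by decide) (by decide) rfl (by decide) (by decide +kernel)
    ⟨by decide +kernel, by decide +kernel⟩ (by decide +kernel) (by decide +kernel)
    (by decide +kernel) (by decide +kernel) (by decide +kernel) checkSystematic_g85
    checkInverse_g85 (by decide +kernel) chunk_g85

/-- The redundancy part of the systematic generator matrix of the first code of length 84. -/
def rows84 : List (List ℕ) :=
  ([2697624115827427366684319486992978920512918915784632479840,
     26040413225074289592399942859183423924052309798419456899140,
     15258133282277106329692160481574187713373950975172533363202,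
     20443789895006814562593033956265526770017945864276712399908,
     15203122784844545950846792190509442407218149145053315248354,
     14248258369113566015880146058049648489539515606066755945499,
     221524693723132233333098316662642762281834886276095414988,
     6669691668332870787387095586221924977385041273926416467084,
     8928571382333260800278640694976627899607225341828949717652,
     13389995394531107937316680900498011378407121829112524181668,
     13356139960453099251959400515494704059195621880275366126674,
     6707064170005225496164284134329701004034793081167827469384,
     7872682147044691993395924331952192307766039278916697925259,
     21984224917213420692357788529362857355046008215284516687944,
     1718358703044973756100464064118852437999970353029795098904,
     9563167385876829319844901612448285291922541297451952874720,
     26680006579540665290667295633912383256748526280598359249626,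
     26691967304497832262745477980623295935288266135680607990048,
     21507885181013199943520722533548819457873380155362778945570]).map (unpack 65)

/-- The coefficients of the systematic generator matrix of the first code of length 84 in terms of
the first rows of the block matrix. -/
def inverse84 : List (List ℕ) :=
  ([9941261247161044, 58600405516732034, 46308960208988192, 28298922719053411, 81954036798326563,
     22915759423493259, 76646002159555332, 59758118074655880, 23196423991104098,
     72130473645721680, 7358090731945994, 40639887200366746, 36453384083252866, 5785858372895434,
     74665802324351064, 21230214777180676, 39450504657122017, 23470351844414482,
     55008567836590337]).map (unpack 19)

/-- The message of a codeword of minimum weight of the first code of length 84. -/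
def light84 : List ℕ := [0, 4, 1, 0, 0, 1, 0, 2, 0, 1, 0, 4, 0, 2, 1, 2, 0, 1, 0]

/-- The bounds for the prefix weights of the messages of the first code of length 84. -/
def caps84 : List ℕ := [1, 1, 1, 1, 3, 3, 3, 3, 5, 5, 5, 5, 7, 7, 7, 7, 9, 9, 9]

theorem checkSystematic_g84 : checkSystematic 21 g84 19 rows84 = true := by decide +kernel

theorem checkInverse_g84 : checkInverse 21 g84 19 inverse84 = true := by decide +kernel

set_option maxHeartbeats 4000000 in
theorem chunk_g84 :
    ∀ c < 13, chunk 5 65 39 9 100000 8 rows84 caps84 13 c = true := by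
  intro c hc
  interval_cases c <;> decide +kernel

theorem hasParameters_g84 : HasParameters (blockCode 21 1 g84) 84 19 41 := by
  refine hasParameters_of_chunks (rows := rows84) (inv := inverse84) (light := light84)
    (caps := caps84) (t := 9) (M := 100000) (D := 8) (K := 13) (by decide) rfl rfl (by decide)
    (by decide) (by decide) rfl (by decide) (by decide +kernel)
    ⟨by decide +kernel, by decide +kernel⟩ (by decide +kernel) (by decide +kernel)
    (by decide +kernel) (by decide +kernel) (by decide +kernel) checkSystematic_g84
    checkInverse_g84 (by decide +kernel) chunk_g84

/-- The redundancy part of the systematic generator matrix of the second code of length 84. -/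
def rows84b : List (List ℕ) :=
  ([5040977512524578135902320484738897680311143824916244003662639251,
     7029603085195656211552338646606066383605539621235092176515510497,
     3584842911933692540057375634506691084751428202911713794687370771,
     5409017797731091072524254933130573436674112148516995588260693514,
     7792263867207981204897195170940642639400955057972891127785233,
     3554611723757270996272664218567924243542435531388837440411739722,
     5145995716515048534641304128308811322961722434458665876185950226,
     3302411083780396409079847926692339755784143472217330064352657412,
     3610416707370081762520401024597420957811062390452016119482029859,
     2108825284367757579199062557260309391184179220613509264441745561,
     1755799918654321324973841210995284157824874144034681925690009626,
     849487267270944696518106525327989643650768255112209215821060250,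
     5349548172812782035980954003725209758998647634010084230207504664]).map (unpack 71)

/-- The coefficients of the systematic generator matrix of the second code of length 84 in terms of
the first rows of the block matrix. -/
def inverse84b : List (List ℕ) :=
  ([39066351305, 240535279634, 2755760272, 12139177492, 174235682402, 165798844619, 69160253074,
     242672575074, 1665147417, 69983078035, 219383605012, 35744748041, 206494119443]).map (unpack 13)

/-- The message of a codeword of minimum weight of the second code of length 84. -/
def light84b : List ℕ := [0, 0, 3, 0, 2, 1, 0, 4, 1, 4, 2, 0, 0]

/-- The bounds for the prefix weights of the messages of the second code of length 84. -/
def caps84b : List ℕ := [3, 3, 3, 3, 3, 3, 6, 6, 6, 6, 6, 6, 10]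

theorem checkSystematic_g84b : checkSystematic 14 g84' 13 rows84b = true := by decide +kernel

theorem checkInverse_g84b : checkInverse 14 g84' 13 inverse84b = true := by decide +kernel

theorem chunk_g84b :
    ∀ c < 1, chunk 5 71 40 10 50000 5 rows84b caps84b 1 c = true := by
  intro c hc
  interval_cases c
  decide +kernel

theorem hasParameters_g84b : HasParameters (blockCode 14 1 g84') 84 13 48 := by
  refine hasParameters_of_chunks (rows := rows84b) (inv := inverse84b) (light := light84b)
    (caps := caps84b) (t := 10) (M := 50000) (D := 5) (K := 1) (by decide) rfl rfl (by decide)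
    (by decide) (by decide) rfl (by decide) (by decide +kernel)
    ⟨by decide +kernel, by decide +kernel⟩ (by decide +kernel) (by decide +kernel)
    (by decide +kernel) (by decide +kernel) (by decide +kernel) checkSystematic_g84b
    checkInverse_g84b (by decide +kernel) chunk_g84b

/-- The redundancy part of the systematic generator matrix of the code of length 65. -/
def rows65 : List (List ℕ) :=
  ([77797027825687293443118360389536986357802953629,
     160181864720959845280550020569029122144374925852,
     414163087912718401198979246556370805884369955057,
     515712104909107621621485305474277419619591784100,
     464808930362894770623826248197863000904638744276,
     194108038545090539952394110945337805833679262571,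
     475729167892292539337353680724817075862777495889,
     482502003011241633675675435769816373415524047179,
     231356872375242378301888997832344285908720694131,
     473233670224016064444487302622965862774517321745,
     562814447453279992511119228596395260613968882610,
     61072014565487644972769849610283332673001972750]).map (unpack 53)

/-- The coefficients of the systematic generator matrix of the code of length 65 in terms of
the first rows of the block matrix. -/
def inverse65 : List (List ℕ) :=
  ([38307138596, 36293960427, 4457970584, 34598898100, 55912207704, 10343637530, 17990983049,
     36778316836, 22743722870, 32515761934, 46897863194, 32488076416]).map (unpack 12)

/-- The message of a codeword of minimum weight of the code of length 65. -/
def light65 : List ℕ := [0, 5, 3, 3, 0, 0, 2, 1, 6, 5, 0, 0]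

/-- The bounds for the prefix weights of the messages of the code of length 65. -/
def caps65 : List ℕ := [2, 2, 2, 2, 2, 5, 5, 5, 5, 5, 8, 8]

theorem checkSystematic_g65 : checkSystematic 13 g65 12 rows65 = true := by decide +kernel

theorem checkInverse_g65 : checkInverse 13 g65 12 inverse65 = true := by decide +kernel

theorem chunk_g65 :
    ∀ c < 1, chunk 7 53 49 8 50000 5 rows65 caps65 1 c = true := by
  intro c hc
  interval_cases c
  decide +kernel

theorem hasParameters_g65 : HasParameters (blockCode 13 1 g65) 65 12 39 := by
  refine hasParameters_of_chunks (rows := rows65) (inv := inverse65) (light := light65)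
    (caps := caps65) (t := 8) (M := 50000) (D := 5) (K := 1) (by decide) rfl rfl (by decide)
    (by decide) (by decide) rfl (by decide) (by decide +kernel)
    ⟨by decide +kernel, by decide +kernel⟩ (by decide +kernel) (by decide +kernel)
    (by decide +kernel) (by decide +kernel) (by decide +kernel) checkSystematic_g65
    checkInverse_g65 (by decide +kernel) chunk_g65

/-- The redundancy part of the systematic generator matrix of the code of length 78. -/
def rows78 : List (List ℕ) :=
  ([22436836890776977409065453538530898712295501742158342731553,
     15952954301405138303381784997456858192304231661465931983018,
     39237064397208816691681527901423833338206653111531794286825,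
     24095014462645333328998589126571241990847072877283481060213,
     16632834104156912307554123185289529342443849844595575372377,
     31889231100969813994248508054346595633628564136065291565381,
     26387242968252945136041057355397589980215038263008637793326,
     34173218854158064602326520563685725032156616887826568633205,
     2384791080871074634820657712167686429119726361185657336721,
     42390780273099540313611874495373586729001643741488808870803,
     2755475161210654626984919459910337649832802989463477750453,
     37959953605515143338423598587511282635210708230550403160840,
     36498783489942884330044959402626253525503531308791069215819]).map (unpack 65)

/-- The coefficients of the systematic generator matrix of the code of length 78 in terms of
the first rows of the block matrix. -/
def inverse78 : List (List ℕ) :=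
  ([302856681729, 29803169890, 263433028331, 263848268126, 431780889682, 302238082384,
     83788663821, 234996026086, 5701188124, 421991880472, 23947915400, 112536683945, 101085104900]).map (unpack 13)

/-- The message of a codeword of minimum weight of the code of length 78. -/
def light78 : List ℕ := [0, 5, 2, 0, 1, 5, 0, 5, 0, 0, 1, 3, 0]

/-- The bounds for the prefix weights of the messages of the code of length 78. -/
def caps78 : List ℕ := [3, 3, 3, 3, 3, 3, 7, 7, 7, 7, 7, 7, 10]

theorem checkSystematic_g78 : checkSystematic 13 g78 13 rows78 = true := by decide +kernel

theorem checkInverse_g78 : checkInverse 13 g78 13 inverse78 = true := by decide +kernel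

theorem chunk_g78 :
    ∀ c < 3, chunk 7 65 45 10 100000 5 rows78 caps78 3 c = true := by
  intro c hc
  interval_cases c <;> decide +kernel

theorem hasParameters_g78 : HasParameters (blockCode 13 1 g78) 78 13 47 := by
  refine hasParameters_of_chunks (rows := rows78) (inv := inverse78) (light := light78)
    (caps := caps78) (t := 10) (M := 100000) (D := 5) (K := 3) (by decide) rfl rfl (by decide)
    (by decide) (by decide) rfl (by decide) (by decide +kernel)
    ⟨by decide +kernel, by decide +kernel⟩ (by decide +kernel) (by decide +kernel)
    (by decide +kernel) (by decide +kernel) (by decide +kernel) checkSystematic_g78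
    checkInverse_g78 (by decide +kernel) chunk_g78

end QTCode

theorem mainTheorem2 :
    (QTCode.IsQuasiTwisted 5 1 (QTCode.interleave (QTCode.blockCode 17 1 QTCode.g85)) ∧
      QTCode.HasParameters (QTCode.blockCode 17 1 QTCode.g85) 85 16 45) ∧
    (QTCode.IsQuasiTwisted 4 1 (QTCode.interleave (QTCode.blockCode 21 1 QTCode.g84)) ∧
      QTCode.HasParameters (QTCode.blockCode 21 1 QTCode.g84) 84 19 41) ∧
    (QTCode.IsQuasiTwisted 6 1 (QTCode.interleave (QTCode.blockCode 14 1 QTCode.g84')) ∧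
      QTCode.HasParameters (QTCode.blockCode 14 1 QTCode.g84') 84 13 48) ∧
    (QTCode.IsQuasiTwisted 5 1 (QTCode.interleave (QTCode.blockCode 13 1 QTCode.g65)) ∧
      QTCode.HasParameters (QTCode.blockCode 13 1 QTCode.g65) 65 12 39) ∧
    (QTCode.IsQuasiTwisted 6 1 (QTCode.interleave (QTCode.blockCode 13 1 QTCode.g78)) ∧
      QTCode.HasParameters (QTCode.blockCode 13 1 QTCode.g78) 78 13 47) := by
  exact ⟨⟨QTCode.isQuasiTwisted_interleave_blockCode (by decide) _, QTCode.hasParameters_g85⟩,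
    ⟨QTCode.isQuasiTwisted_interleave_blockCode (by decide) _, QTCode.hasParameters_g84⟩,
    ⟨QTCode.isQuasiTwisted_interleave_blockCode (by decide) _, QTCode.hasParameters_g84b⟩,
    ⟨QTCode.isQuasiTwisted_interleave_blockCode (by decide) _, QTCode.hasParameters_g65⟩,
    ⟨QTCode.isQuasiTwisted_interleave_blockCode (by decide) _, QTCode.hasParameters_g78⟩⟩
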